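/- Fix an integer $l\ge 0$. Let $M^l$ be the rank $l$ Heisenberg vertex operator algebra over $\mathbb C$, i.e. the Fock space with basis the monomials $a^{i_1}(-k_1)\cdots a^{i_r}(-k_r)\mathbf 1$ ($1\le i_j\le l$, $k_j>0$), with $[a^i(m),a^j(n)]=m\,\delta_{m,-n}\delta_{i,j}$, and with Virasoro vector $\omega=\frac12\sum_{i=1}^l a^i(-1)^2\mathbf 1$. For $\beta\in\mathbb C^l$ let $M_\beta=M^l\otimes e^\beta$ be the irreducible $M^l$-module on which $a^i(0)$ acts as the scalar $\beta^i$ and $a^i(n)$, $n\ne0$, acts on the factor $M^l$; let $\mathcal M=\bigoplus_{\beta\in\mathbb C^l}M_\beta$. For $u\in M^l$ let $Y(u,z)$ be the vertex operator of $u$ on $\mathcal M$, and define $L(n)$ by $Y(\omega,z)=\sum_{n\in\mathbb Z}L(n)z^{-n-2}$. For $\alpha,\beta\in\mathbb C^l$ put $\alpha\cdot\beta=\sum_i\alpha^i\beta^i$, $\alpha(n)=\sum_i\alpha^i a^i(n)$ and $$Y_\pm(\alpha,z)=\exp\Big(\mp\sum_{n>0}\frac{\alpha(\pm n)}{n}z^{\mp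 n}\Big).$$ Let $z^{\alpha(0)}$ act on $M_\beta$ as $z^{\alpha\cdot\beta}$. Let $\epsilon:\mathbb C^l\times\mathbb C^l\to\mathbb C^\times$ satisfy $\epsilon(\alpha,0)=\epsilon(0,\alpha)=1$ and be such that the operators $e^\alpha$ on $\mathcal M$ given by $e^\alpha(u\otimes e^\beta)=\epsilon(\alpha,\beta)\,u\otimes e^{\alpha+\beta}$ satisfy $e^\alpha e^\beta=\epsilon(\alpha,\beta)e^{\alpha+\beta}$ and $e^0=1$. Put $C(\alpha,\beta)=\epsilon(\alpha,\beta)/\epsilon(\beta,\alpha)$ and, for $u\otimes e^\alpha\in M_\alpha$, $$\mathcal Y(u\otimes e^\alpha,z)=e^\alpha\,Y_-(\alpha,z)\,Y(u,z)\,Y_+(\alpha,z)\,z^{\alpha(0)}.$$ Let $N$ be an odd integer, and define the substitution $z\mapsto-z$ in formal series with complex powers of $z$ by $(-z)^\kappa=e^{i\pi N\kappa}z^\kappa$ for $\kappa\in\mathbb C$. Then for all $\alpha,\beta\in\mathbb C^l$ and all $u,v\in M^l$, as formal series in complex powers of $z$ with coefficients in $\mathcal M$, $$\mathcal Y(u\otimes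 e^\alpha,z)(v\otimes e^\beta)=e^{-i\pi N\alpha\cdot\beta}\,C(\alpha,\beta)\,e^{zL(-1)}\,\mathcal Y(v\otimes e^\beta,-z)(u\otimes e^\alpha).$$ -/

import Mathlib

noncomputable section

namespace Heisenberg

/-- The rank `l` Fock space `M^l`. The variable `X (i, n)` stands for the creation operator
`a^i(-n-1)`, so the monomial `∏ X (i_j, n_j)` is the Fock vector
`a^{i_1}(-n_1-1) ⋯ a^{i_r}(-n_r-1) 𝟏`, and `1` is the vacuum `𝟏`. -/
abbrev Fock (l : ℕ) : Type := MvPolynomial (Fin l × ℕ) ℂ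

/-- The direct sum `𝓜 = ⨁_{β ∈ ℂ^l} M_β`, with `M_β = M^l ⊗ e^β`. -/
abbrev FullModule (l : ℕ) : Type := (Fin l → ℂ) →₀ Fock l

/-- The vector `u ⊗ e^α` of `𝓜`. -/
def tensorExp {l : ℕ} (u : Fock l) (α : Fin l → ℂ) : FullModule l := Finsupp.single α u

/-- The action of `a^i(n)` on `M_β`, as an operator on the Fock space:
`a^i(0)` is the scalar `β^i`, `a^i(n+1)` is `(n+1) ∂/∂a^i(-n-1)`, and `a^i(-n-1)` is
multiplication by the variable of that name. -/
def modeOn {l : ℕ} (β : Fin l → ℂ) (i : Fin l) : ℤ → (Fock l →ₗ[ℂ] Fock l)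
  | Int.ofNat 0 => β i • LinearMap.id
  | Int.ofNat (n + 1) => ((n : ℂ) + 1) • (MvPolynomial.pderiv (R := ℂ) (i, n)).toLinearMap
  | Int.negSucc n => LinearMap.mulLeft ℂ (MvPolynomial.X (i, n))

/-- The Heisenberg mode `a^i(n)` on `𝓜`. -/
def mode {l : ℕ} (i : Fin l) (n : ℤ) : FullModule l →ₗ[ℂ] FullModule l :=
  Finsupp.lsum ℂ fun β => Finsupp.lsingle β ∘ₗ modeOn β i n

/-- `α(n) = ∑_i α^i a^i(n)`. -/
def modeDot {l : ℕ} (α : Fin l → ℂ) (n : ℤ) : FullModule l →ₗ[ℂ] FullModule l :=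
  ∑ i, α i • mode i n

/-- The space `𝓜{z}` of formal series in arbitrary complex powers of `z` with coefficients
in `𝓜`; `f κ` is the coefficient of `z^κ`. -/
abbrev Series (l : ℕ) : Type := ℂ → FullModule l

/-- The action on `𝓜{z}` of an operator-valued series `A(z) = ∑_{e ∈ ℤ} A_e z^e`.
It is used only on series for which each of these sums has finitely many nonzero terms. -/
def applySeries {l : ℕ} (A : ℤ → (FullModule l →ₗ[ℂ] FullModule l)) (f : Series l) : Series l :=
  fun κ => ∑ᶠ e : ℤ, A e (f (κ - e))

/-- The action of `exp A(z) = ∑_m A(z)^m / m!` on `𝓜{z}`. -/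
def expSeries {l : ℕ} (A : ℤ → (FullModule l →ₗ[ℂ] FullModule l)) (f : Series l) : Series l :=
  fun κ => ∑ᶠ m : ℕ, ((m.factorial : ℂ)⁻¹) • ((applySeries A)^[m] f) κ

/-- `Y_-(α, z) = exp (∑_{n>0} (α(-n)/n) z^n)`. -/
def Yminus {l : ℕ} (α : Fin l → ℂ) : Series l → Series l :=
  expSeries fun e => if 0 < e then ((e : ℂ)⁻¹) • modeDot α (-e) else 0

/-- `Y_+(α, z) = exp (-∑_{n>0} (α(n)/n) z^{-n})`; here the exponent of `z` is `e = -n`. -/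
def Yplus {l : ℕ} (α : Fin l → ℂ) : Series l → Series l :=
  expSeries fun e => if e < 0 then -((((-e : ℤ) : ℂ)⁻¹) • modeDot α (-e)) else 0

/-- The coefficient of `z^e` in
`(1/k!) ∂_z^k a^i(z) = ∑_n binom(-n-1, k) a^i(n) z^{-n-1-k}`, where `a^i(z) = ∑_n a^i(n) z^{-n-1}`
(so `n = -e-1-k`). -/
def derivField {l : ℕ} (i : Fin l) (k : ℕ) (e : ℤ) : FullModule l →ₗ[ℂ] FullModule l :=
  (Ring.choose (e + k) k : ℤ) • mode i (-e - 1 - k)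

/-- The part of `(1/k!) ∂_z^k a^i(z)` with nonnegative powers of `z` (creation operators). -/
def derivFieldCreate {l : ℕ} (i : Fin l) (k : ℕ) : Series l → Series l :=
  applySeries fun e => if 0 ≤ e then derivField i k e else 0

/-- The part of `(1/k!) ∂_z^k a^i(z)` with negative powers of `z` (zero modes and annihilation
operators). -/
def derivFieldAnnihilate {l : ℕ} (i : Fin l) (k : ℕ) : Series l → Series l :=
  applySeries fun e => if e < 0 then derivField i k e else 0

/-- The normally ordered product `:(1/k_1!)∂^{k_1} a^{i_1}(z) ⋯ (1/k_r!)∂^{k_r} a^{i_r}(z):`,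
by the rule `:A(z) B(z): = A(z)_create B(z) + B(z) A(z)_annihilate`, from the right. -/
def normalOrder {l : ℕ} : List (Fin l × ℕ) → Series l → Series l
  | [], f => f
  | (i, k) :: L, f =>
      derivFieldCreate i k (normalOrder L f) + normalOrder L (derivFieldAnnihilate i k f)

/-- The vertex operator `Y(u, z)` of `u ∈ M^l` on `𝓜` (on `M_β` it is the module vertex operator
`Y_{M_β}(u, z)`): linear in `u`, and equal to the normally ordered product
`:(1/k_1!)∂^{k_1} a^{i_1}(z) ⋯ (1/k_r!)∂^{k_r} a^{i_r}(z):`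
for `u = a^{i_1}(-k_1-1) ⋯ a^{i_r}(-k_r-1) 𝟏`. The factors of a normally ordered product may
be permuted, so it does not matter in which order they are listed. -/
def vertexOp {l : ℕ} (u : Fock l) (f : Series l) : Series l :=
  ∑ m ∈ u.support, u.coeff m • normalOrder (Finsupp.toMultiset m).toList f

/-- The Virasoro vector `ω = (1/2) ∑_i a^i(-1)^2 𝟏`. -/
def virasoroVector (l : ℕ) : Fock l :=
  (2⁻¹ : ℂ) • ∑ i : Fin l, (MvPolynomial.X (i, 0)) ^ 2

/-- The Virasoro modes on `𝓜`, given by `Y(ω, z) = ∑_n L(n) z^{-n-2}`. -/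
def virasoro {l : ℕ} (n : ℤ) (x : FullModule l) : FullModule l :=
  vertexOp (virasoroVector l) (Pi.single 0 x) (-n - 2)

/-- The action of `e^{zL(-1)} = ∑_m (z^m / m!) L(-1)^m` on `𝓜{z}`. -/
def expL {l : ℕ} (f : Series l) : Series l :=
  fun κ => ∑ᶠ m : ℕ, ((m.factorial : ℂ)⁻¹) • ((virasoro (-1))^[m] (f (κ - m)))

/-- `e^{α·q}`, which sends `u ⊗ e^β` to `u ⊗ e^{α+β}`. -/
def expQ {l : ℕ} (α : Fin l → ℂ) : FullModule l →ₗ[ℂ] FullModule l :=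
  Finsupp.lmapDomain (Fock l) ℂ fun β => α + β

/-- `c_α`, which acts on `M_β` as the scalar `ε(α, β)`. -/
def cocycleOp {l : ℕ} (ε : (Fin l → ℂ) → (Fin l → ℂ) → ℂ) (α : Fin l → ℂ) :
    FullModule l →ₗ[ℂ] FullModule l :=
  Finsupp.lsum ℂ fun β => ε α β • Finsupp.lsingle β

/-- The operator `e^α = e^{α·q} c_α` on `𝓜`. -/
def expOp {l : ℕ} (ε : (Fin l → ℂ) → (Fin l → ℂ) → ℂ) (α : Fin l → ℂ) :
    FullModule l →ₗ[ℂ] FullModule l :=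
  expQ α ∘ₗ cocycleOp ε α

/-- The conditions on the cocycle factors `ε(α, β)`: they are nonzero and normalized, and the
operators `e^α` satisfy `e^α e^β = ε(α, β) e^{α+β}` and `e^0 = 1`. -/
structure IsCocycleSystem {l : ℕ} (ε : (Fin l → ℂ) → (Fin l → ℂ) → ℂ) : Prop where
  ne_zero : ∀ α β, ε α β ≠ 0
  right_zero : ∀ α, ε α 0 = 1
  left_zero : ∀ α, ε 0 α = 1
  mul : ∀ α β, expOp ε α ∘ₗ expOp ε β = ε α β • expOp ε (α + β)
  one : expOp ε 0 = LinearMap.id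

/-- The commutator function `C(α, β) = ε(α, β) / ε(β, α)`. -/
def commutator {l : ℕ} (ε : (Fin l → ℂ) → (Fin l → ℂ) → ℂ) (α β : Fin l → ℂ) : ℂ :=
  ε α β / ε β α

/-- `z^{α(0)} x`: the operator `z^{α(0)}` sends `v ⊗ e^β` to `z^{α·β} (v ⊗ e^β)`. -/
def zPowZeroMode {l : ℕ} (α : Fin l → ℂ) (x : FullModule l) : Series l :=
  x.sum fun β v => Pi.single (α ⬝ᵥ β) (tensorExp v β)

/-- The series `𝓨(x, z) y`, where
`𝓨(u ⊗ e^α, z) = e^α Y_-(α, z) Y(u, z) Y_+(α, z) z^{α(0)}`. -/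
def intertwiner {l : ℕ} (ε : (Fin l → ℂ) → (Fin l → ℂ) → ℂ) (x y : FullModule l) : Series l :=
  x.sum fun α u => fun κ =>
    expOp ε α (Yminus α (vertexOp u (Yplus α (zPowZeroMode α y))) κ)

/-- The substitution `z ↦ -z` with the branch `(-z)^κ = e^{iπNκ} z^κ`. -/
def substNeg {l : ℕ} (N : ℤ) (f : Series l) : Series l :=
  fun κ => Complex.exp (Complex.I * Real.pi * N * κ) • f κ

end Heisenberg

end

/-! Both sides are a power `z^{α·β}` times a Laurent series with coefficients in the Fock space,
placed in charge `α+β`, so the claim is an identity in a commutative ring of Laurent series. Write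
`E_γ(z) = exp(∑_{n>0} γ(-n) z^n / n)`. The exponential of annihilators `Y_+(α, z)` is a substitution
`T_α`, namely `a^i(-n-1) ↦ a^i(-n-1) - α^i z^{-n-1}`, so the left side is `ε(α,β) E_α(z) W_β(u, T_α
v)`, where `W_β(u, f)` is the normally ordered product of the fields of `u` on `M_β` applied to `f`
(`intertwiner_tensorExp`).

Let `D` be the translation derivation of the Fock space. On `M_γ`, `L(-1) = D + γ(-1)`. A first
order differential equation gives `e^{zL(-1)} 1 = E_γ(z)`, so `e^{zL(-1)}` is the ring homomorphism
`exp(zD)` times `E_γ(z)`. Hence `z ↦ -z` followed by `e^{zL(-1)}` is a phase times `E_{α+β}(z) ρ`,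
where `ρ` (`reflect`) is the ring endomorphism "`z ↦ -z`, then `exp(zD)`" (`expL_substNeg_place`).

Two facts finish the proof. First, `ρ(E_β) = E_β⁻¹`, so `E_{α+β} ρ(E_β) = E_α`. Second, `ρ(W_α(v,
T_β u)) = W_β(u, T_α v)` (`reflect_wick`): Wick expansion sums over partial contractions between `u`
and `v`, and is symmetric under exchange of fields with variables and of zero modes with shifts
(`wick_swap`); `ρ` performs this exchange on the Heisenberg data (`map_fieldData`). -/

noncomputable section

namespace Heisenberg

/-! ### Wick expansions over a commutative ring and their exchange symmetry. -/

section Wick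

open MvPolynomial

variable {I R : Type*} [CommRing R]

/-- The derivation of `R[X_q : q ∈ I]` with constant coefficients that sends `X q` to `g q`. -/
def contraction (g : I → R) : Derivation R (MvPolynomial I R) (MvPolynomial I R) :=
  mkDerivation R fun q => C (g q)

@[simp]
theorem contraction_X (g : I → R) (q : I) : contraction g (X q) = C (g q) :=
  mkDerivation_X _ _ _

@[simp]
theorem contraction_C (g : I → R) (r : R) : contraction g (C r) = 0 :=
  derivation_C _ _

theorem contraction_mul_X (g : I → R) (f : MvPolynomial I R) (q : I) :
    contraction g (f * X q) = contraction g f * X q + C (g q) * f := by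
  rw [Derivation.leibniz, contraction_X, smul_eq_mul, smul_eq_mul]; ring

theorem contraction_comm (g h : I → R) (f : MvPolynomial I R) :
    contraction g (contraction h f) = contraction h (contraction g f) := by
  induction f using MvPolynomial.induction_on with
  | C a => simp
  | add p q hp hq => simp [hp, hq]
  | mul_X p q hp => simp [hp, Derivation.leibniz]; ring

/-- The translation `X q ↦ X q + d q`. -/
def translation (d : I → R) : MvPolynomial I R →ₐ[R] MvPolynomial I R :=
  aeval fun q => X q + C (d q)

@[simp]
theorem translation_X (d : I → R) (q : I) : translation d (X q) = X q + C (d q) :=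
  aeval_X _ _

@[simp]
theorem translation_C (d : I → R) (r : R) : translation d (C r) = C r :=
  aeval_C _ _

theorem contraction_translation (g d : I → R) (f : MvPolynomial I R) :
    contraction g (translation d f) = translation d (contraction g f) := by
  induction f using MvPolynomial.induction_on with
  | C a => simp
  | add p q hp hq => simp [hp, hq]
  | mul_X p q hp => simp [hp, Derivation.leibniz]

/-- A constant plus a derivation with constant coefficients: the annihilation part of a field. -/
def annihilation (g : I → R) (c : R) : MvPolynomial I R →ₗ[R] MvPolynomial I R :=
  c • LinearMap.id + (contraction g).toLinearMap

theorem annihilation_apply (g : I → R) (c : R) (f : MvPolynomial I R) :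
    annihilation g c f = C c * f + contraction g f := by
  simp [annihilation, smul_eq_C_mul]

theorem annihilation_comm (g h : I → R) (c d : R) (f : MvPolynomial I R) :
    annihilation g c (annihilation h d f) = annihilation h d (annihilation g c f) := by
  simp [annihilation_apply, contraction_comm g h, Derivation.leibniz]; ring

theorem annihilation_translation (g d : I → R) (c : R) (f : MvPolynomial I R) :
    annihilation g c (translation d f) = translation d (annihilation g c f) := by
  simp [annihilation_apply, contraction_translation]

variable (I R) in
/-- The data of a family of free fields indexed by `I`: the creation parts, the images of the
variables, the contractions and the zero modes. -/
structure WickData where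
  /-- The creation part of the field `p`. -/
  create : I → R
  /-- The value of the variable `X p`. -/
  embed : I → R
  /-- The contraction of the field `p` with the variable `X q`. -/
  pairing : I → I → R
  /-- The zero mode of the field `p`. -/
  zeroMode : I → R

/-- The field `p` followed by `φ` in the normal order. -/
def wickStep (w : WickData I R) (p : I) (φ : MvPolynomial I R →ₗ[R] R) :
    MvPolynomial I R →ₗ[R] R :=
  w.create p • φ + φ ∘ₗ annihilation (w.pairing p) (w.zeroMode p)

theorem wickStep_apply (w : WickData I R) (p : I) (φ : MvPolynomial I R →ₗ[R] R)
    (f : MvPolynomial I R) :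
    wickStep w p φ f =
      w.create p * φ f + φ (annihilation (w.pairing p) (w.zeroMode p) f) := rfl

/-- Creation parts are scalars of `R`, and annihilation parts are constants plus
constant-coefficient derivations, which commute. This makes the normal order independent of the
arbitrary order of `toList`. -/
theorem wickStep_comm (w : WickData I R) (p q : I) (φ : MvPolynomial I R →ₗ[R] R) :
    wickStep w p (wickStep w q φ) = wickStep w q (wickStep w p φ) := by
  refine LinearMap.ext fun f => ?_
  simp only [wickStep_apply]
  rw [annihilation_comm (w.pairing p)]
  ring

/-- The normally ordered product of a list of fields. -/
def wickList (w : WickData I R) (L : List I) : MvPolynomial I R →ₗ[R] R :=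
  L.foldr (wickStep w) (aeval w.embed).toLinearMap

theorem wickList_perm (w : WickData I R) {L L' : List I} (h : L.Perm L') :
    wickList w L = wickList w L' :=
  h.foldr_eq' (fun p _ q _ φ => wickStep_comm w q p φ) _

/-- The normally ordered products, as a bilinear map. -/
def wick (w : WickData I R) : MvPolynomial I R →ₗ[R] MvPolynomial I R →ₗ[R] R :=
  (basisMonomials I R).constr R fun m => wickList w (Finsupp.toMultiset m).toList

theorem wick_monomial (w : WickData I R) (m : I →₀ ℕ) (r : R) :
    wick w (monomial m r) = r • wickList w (Finsupp.toMultiset m).toList := by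
  have h : monomial m r = r • basisMonomials I R m := by simp [smul_monomial]
  rw [h, map_smul, wick, Module.Basis.constr_basis]

@[simp]
theorem wick_C (w : WickData I R) (r : R) (f : MvPolynomial I R) :
    wick w (C r) f = r * aeval w.embed f := by
  rw [C_apply, wick_monomial]
  simp [wickList]

/-- Together with `wick_C` this recursion determines `wick`; later inductions on `u` never return to
lists. -/
theorem wick_mul_X (w : WickData I R) (p : I) (u f : MvPolynomial I R) :
    wick w (u * X p) f = w.create p * wick w u f +
      wick w u (annihilation (w.pairing p) (w.zeroMode p) f) := by
  induction u using MvPolynomial.induction_on' with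
  | monomial m r =>
    rw [X, monomial_mul, mul_one, wick_monomial, wick_monomial]
    have h : (Finsupp.toMultiset (m + Finsupp.single p 1)).toList.Perm
        (p :: (Finsupp.toMultiset m).toList) := by
      rw [← Multiset.coe_eq_coe, ← Multiset.cons_coe, Multiset.coe_toList, Multiset.coe_toList]
      simp [← Multiset.singleton_add, add_comm]
    rw [wickList_perm w h]
    change r * wickStep w p (wickList w _) f = _
    rw [wickStep_apply]
    simp only [LinearMap.smul_apply, smul_eq_mul]
    ring
  | add u v hu hv =>
    rw [add_mul, map_add, map_add, LinearMap.add_apply, hu, hv]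
    simp only [LinearMap.add_apply]
    ring

/-- The mirror recursion in the second argument: the variable either survives and is evaluated, or
is contracted with one field of `u`. The commutator of an annihilation part with multiplication by
`X p` is the scalar `pairing q p`. -/
theorem wick_apply_mul_X (w : WickData I R) (p : I) (u f : MvPolynomial I R) :
    wick w u (f * X p) =
      w.embed p * wick w u f + wick w (contraction (fun q => w.pairing q p) u) f := by
  induction u using MvPolynomial.induction_on generalizing f with
  | C a => simp; ring
  | add u v hu hv => simp only [map_add, LinearMap.add_apply, hu, hv]; ring
  | mul_X u q hu =>
    have h : annihilation (w.pairing q) (w.zeroMode q) (f * X p) =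
        annihilation (w.pairing q) (w.zeroMode q) f * X p + w.pairing q p • f := by
      rw [annihilation_apply, annihilation_apply, contraction_mul_X, smul_eq_C_mul]; ring
    rw [wick_mul_X, hu, h, map_add, map_smul, hu, contraction_mul_X, wick_mul_X, map_add,
      LinearMap.add_apply, wick_mul_X, ← smul_eq_C_mul, map_smul, LinearMap.smul_apply,
      smul_eq_mul]
    ring

theorem wick_apply_C (w : WickData I R) (u : MvPolynomial I R) (r : R) :
    wick w u (C r) = r * aeval (fun p => w.create p + w.zeroMode p) u := by
  induction u using MvPolynomial.induction_on with
  | C a => simp; ring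
  | add u v hu hv => simp only [map_add, LinearMap.add_apply, hu, hv]; ring
  | mul_X u q hu =>
    rw [wick_mul_X, annihilation_apply, contraction_C, add_zero, ← smul_eq_C_mul, map_smul, hu,
      map_mul, aeval_X, smul_eq_mul]
    ring

/-- Exchange of the roles of the fields and of the variables. -/
def WickData.swap (w : WickData I R) (d : I → R) : WickData I R where
  create := w.embed
  embed := w.create
  pairing p q := w.pairing q p
  zeroMode := d

theorem aeval_translation (x d : I → R) (f : MvPolynomial I R) :
    aeval x (translation d f) = aeval (fun p => x p + d p) f := by
  rw [translation, ← AlgHom.comp_apply, comp_aeval]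
  congr 2
  ext p
  simp

/-- The recursions `wick_mul_X` and `wick_apply_mul_X` become each other under the swap, except for
zero modes. A zero mode adds a constant to a field, hence appears on the other side as a translation
of the corresponding variable. -/
theorem wick_swap (w : WickData I R) (d : I → R) (u v : MvPolynomial I R) :
    wick w u (translation d v) = wick (w.swap d) v (translation w.zeroMode u) := by
  induction u using MvPolynomial.induction_on generalizing v with
  | C a => rw [wick_C, translation_C, wick_apply_C, aeval_translation]; rfl
  | add u₁ u₂ h₁ h₂ => simp only [map_add, LinearMap.add_apply, h₁, h₂]
  | mul_X u p hu =>
    rw [wick_mul_X, annihilation_translation, hu, hu, map_mul, translation_X, mul_add, map_add,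
      wick_apply_mul_X, mul_comm _ (C _), ← smul_eq_C_mul, map_smul, annihilation_apply,
      map_add, LinearMap.add_apply, ← smul_eq_C_mul, map_smul, LinearMap.smul_apply, smul_eq_mul]
    simp only [WickData.swap]
    ring

variable {S : Type*} [CommRing S]

/-- The image of Wick data under a ring homomorphism. -/
def WickData.map (φ : R →+* S) (w : WickData I R) : WickData I S where
  create p := φ (w.create p)
  embed p := φ (w.embed p)
  pairing p q := φ (w.pairing p q)
  zeroMode p := φ (w.zeroMode p)

theorem map_contraction (φ : R →+* S) (g : I → R) (f : MvPolynomial I R) :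
    MvPolynomial.map φ (contraction g f) =
      contraction (fun q => φ (g q)) (MvPolynomial.map φ f) := by
  induction f using MvPolynomial.induction_on with
  | C a => simp
  | add p q hp hq => simp [hp, hq]
  | mul_X p q hp => simp [hp, Derivation.leibniz]

theorem map_translation (φ : R →+* S) (d : I → R) (f : MvPolynomial I R) :
    MvPolynomial.map φ (translation d f) =
      translation (fun q => φ (d q)) (MvPolynomial.map φ f) := by
  induction f using MvPolynomial.induction_on with
  | C a => simp
  | add p q hp hq => simp [hp, hq]
  | mul_X p q hp => simp [hp]

theorem map_wick (φ : R →+* S) (w : WickData I R) (u f : MvPolynomial I R) :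
    φ (wick w u f) = wick (w.map φ) (MvPolynomial.map φ u) (MvPolynomial.map φ f) := by
  induction u using MvPolynomial.induction_on generalizing f with
  | C a =>
    rw [wick_C, map_C, wick_C, map_mul, aeval_def, aeval_def, Algebra.algebraMap_self,
      Algebra.algebraMap_self, eval₂_map, hom_eval₂]
    rfl
  | add u₁ u₂ h₁ h₂ => simp only [map_add, LinearMap.add_apply, h₁, h₂]
  | mul_X u p hu =>
    rw [wick_mul_X, map_add, map_mul, hu, hu, map_mul, map_X, wick_mul_X, annihilation_apply,
      annihilation_apply, map_add, map_mul, map_C, map_contraction]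
    rfl

/-- Taylor's formula: `f(X + t d) = ∑ t^m D^m f / m!`. -/
theorem iterate_contraction (d : I → R) (f : MvPolynomial I R) (m : ℕ) :
    (contraction d)^[m] f = m.factorial •
      (aeval (fun q => Polynomial.C (X q) + Polynomial.X * Polynomial.C (C (d q)) :
        I → Polynomial (MvPolynomial I R)) f).coeff m := by
  induction f using MvPolynomial.induction_on generalizing m with
  | C a =>
    rw [MvPolynomial.aeval_C, Polynomial.algebraMap_apply, Polynomial.coeff_C]
    cases m with
    | zero => simp [MvPolynomial.algebraMap_eq]
    | succ m => simp [Function.iterate_succ, iterate_map_zero]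
  | add p q hp hq => simp [iterate_map_add, hp, hq]
  | mul_X p q hp =>
    cases m with
    | zero =>
      have := hp 0
      simp at this ⊢
      rw [← this]
    | succ m =>
      -- Leibniz for an iterated derivation has only two terms here, since the second derivative of
      -- `X q` vanishes.
      have h : (contraction d)^[m + 1] (p * X q) =
          (contraction d)^[m + 1] p * X q + (m + 1) • (C (d q) * (contraction d)^[m] p) := by
        clear hp
        induction m with
        | zero =>
          simp only [zero_add, Function.iterate_one, Function.iterate_zero, id, one_smul]
          exact contraction_mul_X d p q
        | succ m ih =>
          rw [Function.iterate_succ_apply', ih, map_add, contraction_mul_X, map_nsmul,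
            Derivation.leibniz, contraction_C, ← Function.iterate_succ_apply' (contraction d),
            ← Function.iterate_succ_apply' (contraction d)]
          simp only [smul_eq_mul, nsmul_eq_mul]
          push_cast
          ring
      rw [h, hp, hp, map_mul, aeval_X, mul_add, Polynomial.coeff_add, Polynomial.coeff_mul_C,
        ← mul_assoc, Polynomial.coeff_mul_C, Polynomial.coeff_mul_X, Nat.factorial_succ]
      simp only [nsmul_eq_mul]
      push_cast
      ring

/-- Taylor's formula at `t = 1`. The additive map `ℓ` stands for coefficient extraction, since `R`
itself need not be a `ℂ`-algebra. -/
theorem finsum_iterate_contraction {V : Type*} [AddCommGroup V] [Module ℂ V] (d : I → R)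
    (ℓ : MvPolynomial I R →+ V) (f : MvPolynomial I R) :
    ∑ᶠ m : ℕ, (m.factorial : ℂ)⁻¹ • ℓ ((contraction d)^[m] f) = ℓ (translation d f) := by
  set P := aeval (fun q => Polynomial.C (X q) + Polynomial.X * Polynomial.C (C (d q)) :
    I → Polynomial (MvPolynomial I R)) f with hP
  have h1 (m : ℕ) : (m.factorial : ℂ)⁻¹ • ℓ ((contraction d)^[m] f) = ℓ (P.coeff m) := by
    rw [iterate_contraction, map_nsmul, ← Nat.cast_smul_eq_nsmul ℂ, smul_smul,
      inv_mul_cancel₀ (by exact_mod_cast m.factorial_ne_zero), one_smul]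
  have h2 : translation d f = P.eval 1 := by
    clear h1
    rw [hP]
    clear hP P
    induction f using MvPolynomial.induction_on with
    | C a => simp [Polynomial.algebraMap_apply, MvPolynomial.algebraMap_eq]
    | add p q hp hq => simp [hp, hq]
    | mul_X p q hp => simp [hp]
  simp only [h1]
  rw [h2, Polynomial.eval_eq_sum, Polynomial.sum, map_sum,
    finsum_eq_sum_of_support_subset (s := P.support)]
  · simp
  · intro m hm
    simp only [Function.mem_support] at hm
    simp only [Finset.mem_coe, Polynomial.mem_support_iff]
    exact fun h => hm (by simp [h])

end Wick

end Heisenberg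

end

noncomputable section

namespace Heisenberg

/-! ### Exponentials `exp(zD)` and `exp S` on power series. -/

section ExpZ

open PowerSeries Finset

variable {A : Type*} [CommRing A] [Algebra ℂ A]

/-- The divided power `D^n / n!`. -/
def dividedPow (D : A →ₗ[ℂ] A) (n : ℕ) : A →ₗ[ℂ] A :=
  (n.factorial : ℂ)⁻¹ • D ^ n

@[simp]
theorem dividedPow_zero (D : A →ₗ[ℂ] A) (a : A) : dividedPow D 0 a = a := by
  simp [dividedPow]

theorem dividedPow_apply (D : A →ₗ[ℂ] A) (n : ℕ) (a : A) :
    dividedPow D n a = (n.factorial : ℂ)⁻¹ • D^[n] a := by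
  simp [dividedPow, Module.End.pow_apply]

theorem dividedPow_succ (D : A →ₗ[ℂ] A) (n : ℕ) (a : A) :
    ((n : ℂ) + 1) • dividedPow D (n + 1) a = D (dividedPow D n a) := by
  rw [dividedPow_apply, dividedPow_apply, map_smul, ← Function.iterate_succ_apply' D, smul_smul,
    Nat.factorial_succ]
  congr 1
  have : (n : ℂ) + 1 ≠ 0 := by exact_mod_cast n.succ_ne_zero
  push_cast
  field_simp

theorem dividedPow_succ' (D : A →ₗ[ℂ] A) (n : ℕ) (a : A) :
    ((n : ℂ) + 1) • dividedPow D (n + 1) a = dividedPow D n (D a) := by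
  rw [dividedPow_succ, dividedPow_apply, dividedPow_apply, map_smul,
    ← Function.iterate_succ_apply' D, Function.iterate_succ_apply]

/-- Three operators are allowed because `L(-1)` on a charged module is not a derivation: it acts as
`D` on one factor and as `L(-1)` on the other. -/
theorem dividedPow_mul {D₁ D₂ D₃ : A →ₗ[ℂ] A}
    (h : ∀ a b, D₃ (a * b) = D₁ a * b + a * D₂ b) (n : ℕ) (a b : A) :
    dividedPow D₃ n (a * b) =
      ∑ p ∈ antidiagonal n, dividedPow D₁ p.1 a * dividedPow D₂ p.2 b := by
  induction n with
  | zero => simp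
  | succ n ih =>
    have hn : (n : ℂ) + 1 ≠ 0 := by exact_mod_cast n.succ_ne_zero
    refine smul_right_injective A hn ?_
    change ((n : ℂ) + 1) • _ = ((n : ℂ) + 1) • _
    rw [dividedPow_succ, ih, map_sum]
    simp only [h, ← dividedPow_succ]
    rw [sum_add_distrib, smul_sum]
    -- Split `n + 1 = p.1 + p.2`; each half lowers one of the two divided powers.
    have h1 : ∀ p ∈ antidiagonal (n + 1),
        ((n : ℂ) + 1) • (dividedPow D₁ p.1 a * dividedPow D₂ p.2 b) =
          (p.1 : ℂ) • (dividedPow D₁ p.1 a * dividedPow D₂ p.2 b) +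
            (p.2 : ℂ) • (dividedPow D₁ p.1 a * dividedPow D₂ p.2 b) := by
      intro p hp
      rw [← add_smul]
      congr 1
      exact_mod_cast (HasAntidiagonal.mem_antidiagonal.1 hp).symm
    rw [sum_congr rfl h1, sum_add_distrib]
    congr 1
    · rw [Finset.Nat.sum_antidiagonal_succ]
      simp
    · rw [Finset.Nat.sum_antidiagonal_succ']
      simp

/-- The coefficients are those of the binomial expansion of `(1 - 1)^{n+1}`. -/
theorem sum_dividedPow_cancel (D : A →ₗ[ℂ] A) (n : ℕ) (a : A) :
    ∑ p ∈ antidiagonal (n + 1), dividedPow D p.1 ((-1) ^ p.2 * dividedPow D p.2 a) = 0 := by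
  have h (p : ℕ × ℕ) (hp : p ∈ antidiagonal (n + 1)) :
      dividedPow D p.1 ((-1) ^ p.2 * dividedPow D p.2 a) =
        (((n + 1).factorial : ℂ)⁻¹ * ((-1) ^ p.2 * ((n + 1).choose p.1 : ℂ))) •
          D^[n + 1] a := by
    have e : ((-1 : A) ^ p.2) * dividedPow D p.2 a = ((-1 : ℂ) ^ p.2) • dividedPow D p.2 a := by
      rw [Algebra.smul_def]; simp
    rw [e, map_smul, dividedPow_apply, dividedPow_apply]
    have hn : ((n + 1).factorial : ℂ) =
        (n + 1).choose p.1 * p.1.factorial * p.2.factorial := by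
      rw [← HasAntidiagonal.mem_antidiagonal.1 hp, ← Nat.add_choose_mul_factorial_mul_factorial, Nat.choose_symm_add]
      push_cast
      rfl
    have h1 : (p.1.factorial : ℂ) ≠ 0 := by exact_mod_cast p.1.factorial_ne_zero
    have h2 : (p.2.factorial : ℂ) ≠ 0 := by exact_mod_cast p.2.factorial_ne_zero
    have h3 : ((n + 1).factorial : ℂ) ≠ 0 := by exact_mod_cast (n + 1).factorial_ne_zero
    have h4 : D^[n + 1] a = D^[p.1] (D^[p.2] a) := by
      rw [← HasAntidiagonal.mem_antidiagonal.1 hp, Function.iterate_add_apply]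
    rw [h4, ← Module.End.pow_apply D p.1, map_smul, smul_smul, smul_smul, Module.End.pow_apply]
    congr 1
    have h5 : ((n + 1).choose p.1 : ℂ) * p.1.factorial * p.2.factorial ≠ 0 := hn ▸ h3
    rw [hn]
    have h6 : ((n + 1).choose p.1 : ℂ) ≠ 0 := left_ne_zero_of_mul (left_ne_zero_of_mul h5)
    field_simp
  rw [sum_congr rfl h, ← sum_smul, ← mul_sum]
  have h0 := (Commute.all (1 : ℂ) (-1)).add_pow' (n + 1)
  simp only [add_neg_cancel, zero_pow n.succ_ne_zero, one_pow, one_mul, nsmul_eq_mul] at h0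
  rw [sum_congr rfl fun p _ => mul_comm _ _, ← h0, mul_zero, zero_smul]

/-- The action of `exp (z D) = ∑ z^n D^n / n!` on formal power series in `z`. -/
def expZ (D : A →ₗ[ℂ] A) (f : PowerSeries A) : PowerSeries A :=
  PowerSeries.mk fun n => ∑ p ∈ antidiagonal n, dividedPow D p.1 (coeff p.2 f)

theorem coeff_expZ (D : A →ₗ[ℂ] A) (f : PowerSeries A) (n : ℕ) :
    coeff n (expZ D f) = ∑ p ∈ antidiagonal n, dividedPow D p.1 (coeff p.2 f) :=
  coeff_mk _ _

theorem coeff_expZ_C (D : A →ₗ[ℂ] A) (a : A) (n : ℕ) :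
    coeff n (expZ D (C a)) = dividedPow D n a := by
  rw [coeff_expZ, sum_eq_single_of_mem (n, 0) (by simp)]
  · simp
  · rintro ⟨i, j⟩ hp hne
    have : j ≠ 0 := by
      rintro rfl
      exact hne (by simpa using hp)
    simp [coeff_C, this]

theorem expZ_add (D : A →ₗ[ℂ] A) (f g : PowerSeries A) :
    expZ D (f + g) = expZ D f + expZ D g := by
  ext n
  simp [coeff_expZ, sum_add_distrib]

theorem expZ_mul {D₁ D₂ D₃ : A →ₗ[ℂ] A}
    (h : ∀ a b, D₃ (a * b) = D₁ a * b + a * D₂ b) (f g : PowerSeries A) :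
    expZ D₃ (f * g) = expZ D₁ f * expZ D₂ g := by
  ext n
  rw [coeff_expZ, coeff_mul]
  simp only [coeff_mul, coeff_expZ, map_sum, dividedPow_mul h, sum_mul_sum, sum_sigma']
  -- Both sides sum over quadruples of total `n`; the bijection transposes the 2×2 array of indices.
  refine sum_nbij' (fun x => ⟨(x.2.2.1 + x.2.1.1, x.2.2.2 + x.2.1.2),
      (x.2.2.1, x.2.1.1), (x.2.2.2, x.2.1.2)⟩)
    (fun x => ⟨(x.2.1.1 + x.2.2.1, x.2.1.2 + x.2.2.2),
      (x.2.1.2, x.2.2.2), (x.2.1.1, x.2.2.1)⟩) ?_ ?_ ?_ ?_ ?_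
  all_goals
    rintro ⟨⟨a, b⟩, ⟨c, d⟩, e, k⟩ hx
    simp only [mem_sigma, HasAntidiagonal.mem_antidiagonal] at hx ⊢
  · obtain ⟨rfl, rfl, rfl⟩ := hx; refine ⟨?_, trivial, trivial⟩; omega
  · obtain ⟨rfl, rfl, rfl⟩ := hx; refine ⟨?_, trivial, trivial⟩; omega
  · obtain ⟨rfl, rfl, rfl⟩ := hx; rfl
  · obtain ⟨rfl, rfl, rfl⟩ := hx; rfl

theorem expZ_rescale_neg_one (D : A →ₗ[ℂ] A) (a : A) :
    expZ D (rescale (-1) (expZ D (C a))) = C a := by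
  ext n
  rw [coeff_expZ]
  simp only [coeff_rescale, coeff_expZ_C]
  cases n with
  | zero => simp
  | succ n => rw [sum_dividedPow_cancel, coeff_C, if_neg n.succ_ne_zero]

/-- `exp (z D)` for a derivation `D`, as a ring homomorphism. -/
def expZHom (D : Derivation ℂ A A) : PowerSeries A →+* PowerSeries A where
  toFun := expZ D.toLinearMap
  map_zero' := by ext n; simp [coeff_expZ]
  map_add' := expZ_add _
  map_one' := by
    rw [← map_one (C (R := A))]
    ext n
    rw [coeff_expZ_C, coeff_C, dividedPow_apply]
    cases n with
    | zero => simp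
    | succ n => simp [Function.iterate_succ_apply, iterate_map_zero]
  map_mul' := expZ_mul fun a b => by simp [add_comm, mul_comm]

theorem expZHom_apply (D : Derivation ℂ A A) (f : PowerSeries A) :
    expZHom D f = expZ D.toLinearMap f := rfl

theorem expZHom_X (D : Derivation ℂ A A) : expZHom D (X : PowerSeries A) = X := by
  rw [expZHom_apply]
  ext n
  rw [coeff_expZ]
  cases n with
  | zero => simp
  | succ n =>
    rw [sum_eq_single_of_mem (n, 1) (by simp)]
    · rw [coeff_one_X, dividedPow_apply, coeff_X]
      cases n with
      | zero => simp
      | succ n => simp [Function.iterate_succ_apply, iterate_map_zero]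
    · rintro ⟨i, j⟩ hp hne
      have : j ≠ 1 := by
        rintro rfl
        exact hne (by simpa using hp)
      simp [coeff_X, this]

/-- Uniqueness for the linear differential equation `f' = h f`. -/
theorem eq_of_derivative_eq_mul {f g h : PowerSeries A}
    (hf : derivative A f = h * f) (hg : derivative A g = h * g)
    (h0 : constantCoeff f = constantCoeff g) : f = g := by
  ext n
  induction n using Nat.strong_induction_on with
  | _ n ih =>
    cases n with
    | zero => simpa using h0
    | succ n =>
      have e : coeff n (derivative A f) = coeff n (derivative A g) := by
        rw [hf, hg, coeff_mul, coeff_mul]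
        refine sum_congr rfl fun p hp => ?_
        rw [ih p.2 (by have := HasAntidiagonal.mem_antidiagonal.1 hp; omega)]
      rw [coeff_derivative, coeff_derivative] at e
      have hn : IsUnit ((n : A) + 1) := by
        have : (n : A) + 1 = algebraMap ℂ A ((n : ℂ) + 1) := by simp
        rw [this]
        exact (IsUnit.mk0 _ (by exact_mod_cast n.succ_ne_zero)).map _
      exact hn.mul_left_injective e

theorem derivative_expZ_C (D : A →ₗ[ℂ] A) (a : A) :
    derivative A (expZ D (C a)) = expZ D (C (D a)) := by
  ext n
  rw [coeff_derivative, coeff_expZ_C, coeff_expZ_C, ← dividedPow_succ', Algebra.smul_def, mul_comm]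
  simp

theorem constantCoeff_expZ_C (D : A →ₗ[ℂ] A) (a : A) :
    constantCoeff (expZ D (C a)) = a := by
  rw [← coeff_zero_eq_constantCoeff_apply, coeff_expZ_C, dividedPow_zero]

/-- The exponential `exp S` of a power series without constant term. -/
def expPS (S : PowerSeries A) : PowerSeries A :=
  PowerSeries.mk fun n => ∑ m ∈ range (n + 1), (m.factorial : ℂ)⁻¹ • coeff n (S ^ m)

theorem coeff_pow_eq_zero {B : Type*} [CommRing B] {S : PowerSeries B}
    (hS : constantCoeff S = 0) {n m : ℕ} (h : n < m) :
    coeff n (S ^ m) = 0 := by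
  obtain ⟨g, rfl⟩ := X_dvd_iff.2 hS
  rw [mul_pow, coeff_X_pow_mul', if_neg (by omega)]

/-- Since `S` is divisible by `z`, powers beyond `n` do not reach the coefficient of `z^n`; any
larger cutoff gives the same sum. -/
theorem coeff_expPS_mul {S : PowerSeries A} (hS : constantCoeff S = 0) (f : PowerSeries A)
    {n N : ℕ} (h : n < N) :
    coeff n (expPS S * f) = ∑ m ∈ range N, (m.factorial : ℂ)⁻¹ • coeff n (S ^ m * f) := by
  simp only [coeff_mul, smul_sum]
  rw [sum_comm]
  refine sum_congr rfl fun p hp => ?_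
  rw [expPS, coeff_mk, sum_mul]
  have hp' := HasAntidiagonal.mem_antidiagonal.1 hp
  rw [sum_subset (range_subset_range.2 (show p.1 + 1 ≤ N by omega))]
  · simp
  · intro m _ hm
    rw [coeff_pow_eq_zero hS (by simpa using hm)]
    simp

theorem constantCoeff_expPS (S : PowerSeries A) : constantCoeff (expPS S) = 1 := by
  rw [← coeff_zero_eq_constantCoeff_apply, expPS, coeff_mk]
  simp

theorem derivative_expPS {S : PowerSeries A} (hS : constantCoeff S = 0) :
    derivative A (expPS S) = derivative A S * expPS S := by
  ext n
  -- Differentiation sends the `m+1` term to the `m` term, so the cutoffs `n + 2` and `n + 1` match.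
  have h1 := coeff_expPS_mul hS 1 (n := n + 1) (N := n + 2) (by omega)
  rw [coeff_derivative, mul_comm (derivative A S), coeff_expPS_mul hS _ (n := n) (N := n + 1) (by omega)]
  rw [mul_one] at h1
  rw [h1, sum_range_succ', add_mul, sum_mul]
  simp only [mul_one, pow_zero, coeff_one, n.succ_ne_zero, if_false, smul_zero, zero_mul, add_zero]
  refine sum_congr rfl fun m _ => ?_
  have e : coeff (n + 1) (S ^ (m + 1)) * ((n : A) + 1) =
      ((m : ℂ) + 1) • coeff n (S ^ m * derivative A S) := by
    rw [← coeff_derivative, derivative_pow]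
    simp only [Nat.add_sub_cancel, Nat.cast_add, Nat.cast_one]
    rw [mul_assoc, ← map_natCast (C (R := A)), ← map_one (C (R := A)), ← map_add, coeff_C_mul,
      Algebra.smul_def]
    simp
  rw [smul_mul_assoc, e, smul_smul, Nat.factorial_succ]
  congr 1
  have : (m : ℂ) + 1 ≠ 0 := by exact_mod_cast m.succ_ne_zero
  push_cast
  field_simp

end ExpZ

end Heisenberg

end

noncomputable section

namespace Heisenberg

/-! ### The translation operator, creation series and `e^{zL(-1)}` on the Fock space. -/

section FockSeries

open MvPolynomial

variable {l : ℕ}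

/-- The translation operator of the Fock space: the derivation with
`a^i(-n-1) ↦ (n+1) a^i(-n-2)`. -/
def fockTranslation (l : ℕ) : Derivation ℂ (Fock l) (Fock l) :=
  mkDerivation ℂ fun q => ((q.2 : ℂ) + 1) • X (q.1, q.2 + 1)

/-- `γ(-n-1) 𝟏`. -/
def fockDot (γ : Fin l → ℂ) (n : ℕ) : Fock l :=
  ∑ i, γ i • X (i, n)

/-- The operator `L(-1)` on `M_γ`. -/
def fockL (γ : Fin l → ℂ) : Fock l →ₗ[ℂ] Fock l :=
  (fockTranslation l).toLinearMap + LinearMap.mulLeft ℂ (fockDot γ 0)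

theorem fockL_apply (γ : Fin l → ℂ) (x : Fock l) :
    fockL γ x = fockTranslation l x + fockDot γ 0 * x := rfl

theorem fockL_mul (γ : Fin l → ℂ) (a b : Fock l) :
    fockL γ (a * b) = fockTranslation l a * b + a * fockL γ b := by
  simp only [fockL_apply, Derivation.leibniz, smul_eq_mul]
  ring

theorem dividedPow_fockTranslation_X (p : Fin l × ℕ) (n : ℕ) :
    dividedPow (fockTranslation l).toLinearMap n (X p) =
      ((p.2 + n).choose p.2 : ℂ) • X (p.1, p.2 + n) := by
  induction n with
  | zero => simp
  | succ n ih =>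
    have hn : (n : ℂ) + 1 ≠ 0 := by exact_mod_cast n.succ_ne_zero
    refine smul_right_injective (Fock l) hn ?_
    change ((n : ℂ) + 1) • _ = ((n : ℂ) + 1) • _
    rw [dividedPow_succ, ih, map_smul]
    change _ • fockTranslation l (X _) = _
    rw [fockTranslation, mkDerivation_X, smul_smul, smul_smul, add_assoc]
    congr 1
    have h := Nat.choose_mul_succ_eq (p.2 + n) p.2
    have e : p.2 + n + 1 - p.2 = n + 1 := by omega
    rw [e] at h
    have h' : (((p.2 + n).choose p.2 * (p.2 + n + 1) : ℕ) : ℂ) =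
      (((p.2 + n + 1).choose p.2 * (n + 1) : ℕ) : ℂ) := by rw [h]
    push_cast at h' ⊢
    rw [h', mul_comm, ← add_assoc]

/-- The creation part `∑_e binom(e+k, k) a^i(-e-k-1) z^e` of the field of `a^i(-k-1) 𝟏`. -/
def createSeries (p : Fin l × ℕ) : PowerSeries (Fock l) :=
  PowerSeries.mk fun e => ((p.2 + e).choose p.2 : ℂ) • X (p.1, p.2 + e)

/-- This is `Y(u, z) 𝟏 = e^{zL(-1)} u` for a generator `u`. -/
theorem expZHom_C_X (p : Fin l × ℕ) :
    expZHom (fockTranslation l) (PowerSeries.C (X p)) = createSeries p := by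
  ext1 n
  rw [expZHom_apply, coeff_expZ_C, dividedPow_fockTranslation_X, createSeries,
    PowerSeries.coeff_mk]

theorem expZHom_rescale_createSeries (p : Fin l × ℕ) :
    expZHom (fockTranslation l) (PowerSeries.rescale (-1) (createSeries p)) =
      PowerSeries.C (X p) := by
  rw [← expZHom_C_X, expZHom_apply, expZHom_apply, expZ_rescale_neg_one]

/-- `∑_{n>0} (γ(-n)/n) z^n`. -/
def logSeries (γ : Fin l → ℂ) : PowerSeries (Fock l) :=
  PowerSeries.mk fun n => (n : ℂ)⁻¹ • fockDot γ (n - 1)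

/-- At `n = 0` the truncated index `n - 1` is harmless, because `0⁻¹ = 0`. -/
theorem constantCoeff_logSeries (γ : Fin l → ℂ) :
    PowerSeries.constantCoeff (logSeries γ) = 0 := by
  rw [← PowerSeries.coeff_zero_eq_constantCoeff_apply, logSeries, PowerSeries.coeff_mk]
  simp

theorem derivative_logSeries (γ : Fin l → ℂ) :
    PowerSeries.derivative (Fock l) (logSeries γ) =
      expZHom (fockTranslation l) (PowerSeries.C (fockDot γ 0)) := by
  ext1 n
  have hn : (n : ℂ) + 1 ≠ 0 := by exact_mod_cast n.succ_ne_zero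
  have e : ((n : Fock l) + 1) = C ((n : ℂ) + 1) := by simp
  rw [PowerSeries.coeff_derivative, expZHom_apply, coeff_expZ_C, logSeries, PowerSeries.coeff_mk,
    fockDot, fockDot, map_sum, e, mul_comm, ← smul_eq_C_mul, smul_smul]
  simp only [map_smul, dividedPow_fockTranslation_X]
  push_cast
  rw [mul_inv_cancel₀ hn]
  simp

/-- `exp (∑_{n>0} (γ(-n)/n) z^n)`. -/
def expLogSeries (γ : Fin l → ℂ) : PowerSeries (Fock l) :=
  expPS (logSeries γ)

theorem derivative_expLogSeries (γ : Fin l → ℂ) :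
    PowerSeries.derivative (Fock l) (expLogSeries γ) =
      expZHom (fockTranslation l) (PowerSeries.C (fockDot γ 0)) * expLogSeries γ := by
  rw [expLogSeries, derivative_expPS (constantCoeff_logSeries γ), derivative_logSeries]

theorem expZ_fockL_mul (γ : Fin l → ℂ) (f g : PowerSeries (Fock l)) :
    expZ (fockL γ) (f * g) = expZHom (fockTranslation l) f * expZ (fockL γ) g :=
  expZ_mul (fockL_mul γ) f g

/-- Both sides solve `f' = (exp(zD) γ(-1)𝟏) f` with `f(0) = 1`. -/
theorem expZ_fockL_one (γ : Fin l → ℂ) :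
    expZ (fockL γ) (PowerSeries.C 1) = expLogSeries γ := by
  refine eq_of_derivative_eq_mul ?_ (derivative_expLogSeries γ) ?_
  · rw [derivative_expZ_C, ← expZ_fockL_mul, ← map_mul]
    congr 2
    rw [fockL_apply, Derivation.map_one_eq_zero, zero_add]
  · rw [constantCoeff_expZ_C, expLogSeries, constantCoeff_expPS]

theorem expZ_fockL (γ : Fin l → ℂ) (f : PowerSeries (Fock l)) :
    expZ (fockL γ) f = expZHom (fockTranslation l) f * expLogSeries γ := by
  rw [← expZ_fockL_one, ← expZ_fockL_mul, map_one, mul_one]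

theorem expLogSeries_add (α β : Fin l → ℂ) :
    expLogSeries (α + β) = expLogSeries α * expLogSeries β := by
  refine eq_of_derivative_eq_mul (derivative_expLogSeries _) ?_ ?_
  · have h : fockDot (α + β) 0 = fockDot α 0 + fockDot β 0 := by
      simp [fockDot, add_smul, Finset.sum_add_distrib]
    rw [Derivation.leibniz, derivative_expLogSeries, derivative_expLogSeries, h, map_add, map_add,
      smul_eq_mul, smul_eq_mul]
    ring
  · simp [expLogSeries, constantCoeff_expPS]

/-- This is `e^{zL(-1)} e^{-zL(-1)} 1 = 1` on `M_β`, read through the factorization `expZ_fockL`. -/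
theorem expLogSeries_mul_cancel (β : Fin l → ℂ) :
    expLogSeries β *
      expZHom (fockTranslation l) (PowerSeries.rescale (-1) (expLogSeries β)) = 1 := by
  rw [mul_comm, ← expZ_fockL, ← expZ_fockL_one, expZ_rescale_neg_one, map_one]

end FockSeries

/-! ### Laurent series and the reflection `z ↦ -z`, then `exp(zD)`. -/

section Laurent

open HahnSeries

/-- Laurent series with coefficients in the Fock space. -/
abbrev FockLaurent (l : ℕ) : Type := LaurentSeries (Fock l)

variable {A : Type*} [CommRing A]

theorem exists_eq_single_mul (f : LaurentSeries A) :
    ∃ (n : ℕ) (g : PowerSeries A), f = single (-n : ℤ) 1 * ofPowerSeries ℤ A g := by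
  obtain ⟨⟨g, ⟨_, n, rfl⟩⟩, h⟩ :=
    IsLocalization.surj (Submonoid.powers (PowerSeries.X : PowerSeries A)) f
  refine ⟨n, g, ?_⟩
  simp only [LaurentSeries.coe_algebraMap, ofPowerSeries_X_pow] at h
  rw [← h, mul_comm f, ← mul_assoc, single_mul_single]
  simp

theorem coeff_single_mul_ofPowerSeries (n : ℕ) (g : PowerSeries A) (k : ℤ) :
    (single (-n : ℤ) 1 * ofPowerSeries ℤ A g : LaurentSeries A).coeff k =
      if k + n < 0 then 0 else PowerSeries.coeff (k + n).natAbs g := by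
  have : k = k + n + -(n : ℤ) := by ring
  conv_lhs => rw [this]
  rw [coeff_single_mul_add, one_mul, PowerSeries.coeff_coe]

theorem finsum_int_eq_sum_range {V : Type*} [AddCommMonoid V] (F : ℤ → V) (N : ℕ)
    (h1 : ∀ e < 0, F e = 0) (h2 : ∀ e > (N : ℤ), F e = 0) :
    ∑ᶠ e : ℤ, F e = ∑ e ∈ Finset.range (N + 1), F e := by
  rw [finsum_eq_sum_of_support_subset F (s := (Finset.range (N + 1)).map Nat.castEmbedding)]
  · simp
  · intro e he
    rw [Function.mem_support] at he
    have h3 : 0 ≤ e := by by_contra h; exact he (h1 e (by omega))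
    have h4 : e ≤ N := by by_contra h; exact he (h2 e (by omega))
    simp only [Finset.coe_map, Set.mem_image, Finset.mem_coe, Finset.mem_range]
    exact ⟨e.toNat, by omega, by simp [h3]⟩

theorem finsum_nat_eq_sum_range {V : Type*} [AddCommMonoid V] (F : ℕ → V) (N : ℕ)
    (h : ∀ e ≥ N, F e = 0) :
    ∑ᶠ e : ℕ, F e = ∑ e ∈ Finset.range N, F e := by
  refine finsum_eq_sum_of_support_subset F fun e he => ?_
  rw [Function.mem_support] at he
  by_contra h'
  exact he (h e (by simpa using h'))

theorem coeff_ofPowerSeries_mul (c : PowerSeries A) (f : LaurentSeries A) (k : ℤ) :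
    (ofPowerSeries ℤ A c * f).coeff k =
      ∑ᶠ e : ℤ, (if 0 ≤ e then PowerSeries.coeff e.toNat c else 0) * f.coeff (k - e) := by
  obtain ⟨n, g, rfl⟩ := exists_eq_single_mul f
  rw [mul_left_comm, ← map_mul, coeff_single_mul_ofPowerSeries]
  simp only [coeff_single_mul_ofPowerSeries]
  split_ifs with h
  · rw [finsum_eq_zero_of_forall_eq_zero]
    intro e
    split_ifs <;> first | simp | omega
  · rw [finsum_int_eq_sum_range _ (k + n).natAbs, PowerSeries.coeff_mul,
      Finset.Nat.sum_antidiagonal_eq_sum_range_succ_mk]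
    · refine Finset.sum_congr rfl fun e he => ?_
      rw [Finset.mem_range] at he
      rw [if_pos (by positivity), if_neg (by omega)]
      simp only [Int.toNat_natCast]
      congr 3
      omega
    · intro e he
      rw [if_neg (by omega), zero_mul]
    · intro e he
      rw [if_pos (by omega : k - e + n < 0), mul_zero]

variable [Algebra ℂ A]

theorem coeff_ofPowerSeries_expPS_mul {S : PowerSeries A} (hS : PowerSeries.constantCoeff S = 0)
    (f : LaurentSeries A) (k : ℤ) :
    (ofPowerSeries ℤ A (expPS S) * f).coeff k =
      ∑ᶠ m : ℕ, (m.factorial : ℂ)⁻¹ • ((fun h => ofPowerSeries ℤ A S * h)^[m] f).coeff k := by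
  simp only [mul_left_iterate]
  obtain ⟨n, g, rfl⟩ := exists_eq_single_mul f
  simp only [← map_pow]
  simp only [mul_left_comm _ (single (-n : ℤ) (1 : A)), ← map_mul, coeff_single_mul_ofPowerSeries]
  split_ifs with h
  · simp
  · rw [finsum_nat_eq_sum_range _ ((k + n).natAbs + 1), coeff_expPS_mul hS _ (Nat.lt_succ_self _)]
    intro m hm
    rw [PowerSeries.coeff_mul, Finset.sum_eq_zero, smul_zero]
    intro p hp
    rw [coeff_pow_eq_zero hS, zero_mul]
    have := Finset.HasAntidiagonal.mem_antidiagonal.1 hp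
    omega

/-- `X` goes to `-X`, a unit among Laurent series, so the map on power series extends to the
localization at `X`. -/
theorem isUnit_reflect_X_pow (D : Derivation ℂ A A)
    (y : Submonoid.powers (PowerSeries.X : PowerSeries A)) :
    IsUnit ((ofPowerSeries ℤ A).comp ((expZHom D).comp (PowerSeries.rescale (-1))) y) := by
  obtain ⟨_, n, rfl⟩ := y
  simp only [map_pow, RingHom.comp_apply, PowerSeries.rescale_neg_one_X, map_neg, expZHom_X,
    ofPowerSeries_X]
  refine IsUnit.pow _ (IsUnit.neg ?_)
  exact IsUnit.of_mul_eq_one (single (-1 : ℤ) 1) (by rw [single_mul_single]; simp)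

/-- The ring endomorphism `z ↦ -z` followed by `exp (z D)` on Laurent series. -/
def reflect (D : Derivation ℂ A A) : LaurentSeries A →+* LaurentSeries A :=
  IsLocalization.lift (isUnit_reflect_X_pow D)

theorem reflect_ofPowerSeries (D : Derivation ℂ A A) (g : PowerSeries A) :
    reflect D (ofPowerSeries ℤ A g) =
      ofPowerSeries ℤ A (expZHom D (PowerSeries.rescale (-1) g)) :=
  IsLocalization.lift_eq (isUnit_reflect_X_pow D) g

theorem reflect_single_neg (D : Derivation ℂ A A) (n : ℕ) :
    reflect D (single (-n : ℤ) 1) = (-1) ^ n * single (-n : ℤ) 1 := by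
  have h1 : reflect D (single (n : ℤ) 1) = (-1) ^ n * single (n : ℤ) 1 := by
    rw [← ofPowerSeries_X_pow, reflect_ofPowerSeries, map_pow, map_pow,
      PowerSeries.rescale_neg_one_X, map_neg, expZHom_X, neg_pow, map_mul, map_pow, map_neg,
      map_one]
  have h2 : (single (n : ℤ) 1 * single (-n : ℤ) 1 : LaurentSeries A) = 1 := by
    rw [single_mul_single]; simp
  have h3 := congrArg (reflect D) h2
  rw [map_mul, h1, map_one (reflect D)] at h3
  have h4 : ((-1) ^ n * (-1) ^ n : LaurentSeries A) = 1 := by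
    rw [← mul_pow]; simp
  calc reflect D (single (-n : ℤ) 1)
      = ((-1) ^ n * (-1) ^ n) * (single (n : ℤ) 1 * single (-n : ℤ) 1) *
          reflect D (single (-n : ℤ) 1) := by rw [h2, h4]; simp
    _ = (-1) ^ n * single (-n : ℤ) 1 *
          ((-1) ^ n * single (n : ℤ) 1 * reflect D (single (-n : ℤ) 1)) := by ring
    _ = _ := by rw [h3, mul_one]

end Laurent

section LaurentFock

open HahnSeries

variable {l : ℕ}

/-- The right side is the coefficient of `e^{zL(-1)} f(-z)` in charge `γ`. Clearing the pole of `f`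
reduces it to `expZ_fockL`. -/
theorem coeff_expLogSeries_mul_reflect (γ : Fin l → ℂ) (f : FockLaurent l) (k : ℤ) :
    (ofPowerSeries ℤ _ (expLogSeries γ) * reflect (fockTranslation l) f).coeff k =
      ∑ᶠ m : ℕ, (m.factorial : ℂ)⁻¹ •
        (fockL γ)^[m] ((-1 : ℂ) ^ (k - m : ℤ) • f.coeff (k - m)) := by
  obtain ⟨n, g, rfl⟩ := exists_eq_single_mul f
  have e : ((-1) ^ n : FockLaurent l) = ofPowerSeries ℤ _ ((-1) ^ n) := by simp
  rw [map_mul, reflect_ofPowerSeries, reflect_single_neg, e, mul_assoc,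
    mul_left_comm _ (single _ _), ← map_mul, mul_left_comm _ (single _ _), ← map_mul,
    mul_left_comm, mul_comm (expLogSeries γ), ← expZ_fockL]
  simp only [coeff_single_mul_ofPowerSeries]
  split_ifs with h
  · rw [finsum_eq_zero_of_forall_eq_zero]
    intro m
    rw [if_pos (by omega), smul_zero, iterate_map_zero, smul_zero]
  · rw [finsum_nat_eq_sum_range _ ((k + n).natAbs + 1)]
    · have e' : ((-1) ^ n : PowerSeries (Fock l)) = PowerSeries.C ((-1) ^ n) := by simp
      rw [e', PowerSeries.coeff_C_mul, coeff_expZ,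
        Finset.Nat.sum_antidiagonal_eq_sum_range_succ_mk, Finset.mul_sum]
      refine Finset.sum_congr rfl fun m hm => ?_
      rw [Finset.mem_range] at hm
      rw [if_neg (by omega), dividedPow_apply, PowerSeries.coeff_rescale]
      have h1 : (k - m + n).natAbs = (k + n).natAbs - m := by omega
      have h2 : (-1 : ℂ) ^ (k - m : ℤ) = (-1) ^ n * (-1) ^ ((k + n).natAbs - m) := by
        have : k - m = (((k + n).natAbs - m : ℕ) : ℤ) - n := by omega
        rw [this, zpow_sub₀ (by norm_num), zpow_natCast, zpow_natCast, div_eq_mul_inv, mul_comm,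
          ← inv_pow]
        norm_num
      rw [h1, h2, ← Module.End.pow_apply, ← Module.End.pow_apply]
      have h3 : ((-1 : Fock l) ^ ((k + n).natAbs - m)) *
          PowerSeries.coeff ((k + n).natAbs - m) g =
          ((-1 : ℂ) ^ ((k + n).natAbs - m)) • PowerSeries.coeff ((k + n).natAbs - m) g := by
        rw [Algebra.smul_def]; simp
      have h4 (y : Fock l) : (-1) ^ n * y = ((-1 : ℂ) ^ n) • y := by
        rw [Algebra.smul_def]; simp
      rw [h3, h4, map_smul, map_smul, smul_comm, mul_smul, smul_comm ((-1 : ℂ) ^ n)]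
    · intro m hm
      rw [if_pos (by omega), smul_zero, iterate_map_zero, smul_zero]

end LaurentFock

end Heisenberg

end

noncomputable section

namespace Heisenberg

open HahnSeries

variable {l : ℕ}

/-! ### From series in complex powers of `z` to Laurent series. -/

section Place

/-- The series `z^{κ₀} f(z) ⊗ e^γ`, for a Laurent series `f` with coefficients in the Fock
space. -/
def place (κ₀ : ℂ) (γ : Fin l → ℂ) : FockLaurent l →+ Series l :=
  open scoped Classical in
  { toFun f κ := Finsupp.single γ (if h : ∃ n : ℤ, κ = κ₀ + n then f.coeff h.choose else 0)
    map_zero' := by funext κ; simp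
    map_add' f g := by
      funext κ
      rw [Pi.add_apply, ← Finsupp.single_add]
      split_ifs <;> simp }

theorem place_apply (κ₀ : ℂ) (γ : Fin l → ℂ) (f : FockLaurent l) (n : ℤ) :
    place κ₀ γ f (κ₀ + n) = Finsupp.single γ (f.coeff n) := by
  have h : ∃ m : ℤ, κ₀ + n = κ₀ + m := ⟨n, rfl⟩
  have h' : h.choose = n := by exact_mod_cast (add_left_cancel h.choose_spec).symm
  simp only [place, AddMonoidHom.coe_mk, ZeroHom.coe_mk]
  rw [dif_pos h, h']

theorem place_apply_of_not {κ₀ κ : ℂ} (h : ¬∃ n : ℤ, κ = κ₀ + n) (γ : Fin l → ℂ)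
    (f : FockLaurent l) : place κ₀ γ f κ = 0 := by
  simp only [place, AddMonoidHom.coe_mk, ZeroHom.coe_mk]
  rw [dif_neg h, Finsupp.single_zero]

theorem eq_place {κ₀ : ℂ} {γ : Fin l → ℂ} {s : Series l} {f : FockLaurent l}
    (h1 : ∀ n : ℤ, s (κ₀ + n) = Finsupp.single γ (f.coeff n))
    (h2 : ∀ κ, (¬∃ n : ℤ, κ = κ₀ + n) → s κ = 0) : s = place κ₀ γ f := by
  funext κ
  by_cases h : ∃ n : ℤ, κ = κ₀ + n
  · obtain ⟨n, rfl⟩ := h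
    rw [h1, place_apply]
  · rw [h2 κ h, place_apply_of_not h]

theorem not_exists_sub {κ₀ κ : ℂ} (h : ¬∃ n : ℤ, κ = κ₀ + n) (e : ℤ) :
    ¬∃ n : ℤ, κ - e = κ₀ + n := by
  rintro ⟨n, hn⟩
  exact h ⟨n + e, by push_cast; rw [← add_assoc, ← hn]; ring⟩

theorem place_C_mul (κ₀ : ℂ) (γ : Fin l → ℂ) (a : ℂ) (f : FockLaurent l) :
    place κ₀ γ (HahnSeries.C (MvPolynomial.C a) * f) = a • place κ₀ γ f := by
  refine (eq_place (fun n => ?_) fun κ h => ?_).symm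
  · rw [Pi.smul_apply, place_apply, Finsupp.smul_single, C_mul_eq_smul, coeff_smul,
      smul_eq_mul, ← MvPolynomial.smul_eq_C_mul]
  · rw [Pi.smul_apply, place_apply_of_not h, smul_zero]

/-- Injectivity preserves supports, so no finiteness is needed: infinite sums default to zero on
both sides. -/
theorem map_finsum_single (γ : Fin l → ℂ) {J : Sort*} (F : J → Fock l) :
    Finsupp.single γ (∑ᶠ e, F e) = ∑ᶠ e, Finsupp.single γ (F e) :=
  (Finsupp.singleAddHom γ).map_finsum_of_injective (Finsupp.single_injective γ) F

theorem applySeries_place {κ₀ : ℂ} {γ : Fin l → ℂ}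
    {A : ℤ → (FullModule l →ₗ[ℂ] FullModule l)} {a : ℤ → Fock l → Fock l}
    (hA : ∀ e x, A e (Finsupp.single γ x) = Finsupp.single γ (a e x))
    {f h : FockLaurent l} (hf : ∀ k, ∑ᶠ e : ℤ, a e (f.coeff (k - e)) = h.coeff k) :
    applySeries A (place κ₀ γ f) = place κ₀ γ h := by
  refine eq_place (fun k => ?_) fun κ hκ => ?_
  · rw [← hf, map_finsum_single, applySeries]
    refine finsum_congr fun e => ?_
    have h : κ₀ + (k : ℂ) - e = κ₀ + ((k - e : ℤ) : ℂ) := by push_cast; ring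
    rw [h, place_apply, hA]
  · rw [applySeries, finsum_eq_zero_of_forall_eq_zero]
    intro e
    rw [place_apply_of_not (not_exists_sub hκ e), map_zero]

theorem Pi_single_eq_place (κ₀ : ℂ) (γ : Fin l → ℂ) (x : Fock l) :
    (Pi.single κ₀ (Finsupp.single γ x) : Series l) = place κ₀ γ (HahnSeries.C x) := by
  refine eq_place (fun n => ?_) fun κ h => ?_
  · rw [HahnSeries.C_apply, coeff_single]
    by_cases hn : n = 0
    · subst hn
      simp
    · rw [Pi.single_eq_of_ne (by simpa using hn), if_neg hn, Finsupp.single_zero]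
  · refine Pi.single_eq_of_ne ?_ _
    rintro rfl
    exact h ⟨0, by simp⟩

end Place

/-! ### Creation operators as multiplication by power series. -/

section Modes

theorem mode_single (β : Fin l → ℂ) (i : Fin l) (n : ℤ) (x : Fock l) :
    mode i n (Finsupp.single β x) = Finsupp.single β (modeOn β i n x) := by
  simp [mode]

theorem modeDot_single (α β : Fin l → ℂ) (n : ℤ) (x : Fock l) :
    modeDot α n (Finsupp.single β x) = Finsupp.single β (∑ i, α i • modeOn β i n x) := by
  simp only [modeDot, LinearMap.sum_apply, LinearMap.smul_apply, mode_single,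
    Finsupp.smul_single, Finsupp.single_finsetSum]

theorem modeOn_neg (β : Fin l → ℂ) (i : Fin l) (n : ℕ) (x : Fock l) :
    modeOn β i (-(n : ℤ) - 1) x = MvPolynomial.X (i, n) * x := by
  have : -(n : ℤ) - 1 = Int.negSucc n := by omega
  rw [this]
  rfl

theorem modeOn_succ (β : Fin l → ℂ) (i : Fin l) (n : ℕ) (x : Fock l) :
    modeOn β i ((n : ℤ) + 1) x = ((n : ℂ) + 1) • MvPolynomial.pderiv (i, n) x := rfl

theorem modeOn_zero (β : Fin l → ℂ) (i : Fin l) (x : Fock l) :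
    modeOn β i 0 x = β i • x := rfl

theorem derivField_single (β : Fin l → ℂ) (i : Fin l) (k : ℕ) (e : ℤ) (x : Fock l) :
    derivField i k e (Finsupp.single β x) =
      Finsupp.single β ((Ring.choose (e + k) k : ℤ) • modeOn β i (-e - 1 - k) x) := by
  rw [derivField, LinearMap.smul_apply, mode_single, Finsupp.smul_single]

theorem derivFieldCreate_place (κ₀ : ℂ) (γ : Fin l → ℂ) (p : Fin l × ℕ) (f : FockLaurent l) :
    derivFieldCreate p.1 p.2 (place κ₀ γ f) =
      place κ₀ γ (ofPowerSeries ℤ _ (createSeries p) * f) := by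
  refine applySeries_place (a := fun e x =>
    (if 0 ≤ e then PowerSeries.coeff e.toNat (createSeries p) else 0) * x) (fun e x => ?_)
    fun k => (coeff_ofPowerSeries_mul _ _ _).symm
  split_ifs with he
  · lift e to ℕ using he
    rw [derivField_single]
    have h1 : -(e : ℤ) - 1 - p.2 = -((p.2 + e : ℕ) : ℤ) - 1 := by push_cast; ring
    have h2 : (e : ℤ) + p.2 = ((p.2 + e : ℕ) : ℤ) := by push_cast; ring
    rw [h1, h2, modeOn_neg, Ring.choose_natCast, Int.toNat_natCast, createSeries,
      PowerSeries.coeff_mk, smul_mul_assoc]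
    simp [Nat.cast_smul_eq_nsmul]
  · simp

theorem Yminus_place (κ₀ : ℂ) (α γ : Fin l → ℂ) (f : FockLaurent l) :
    Yminus α (place κ₀ γ f) = place κ₀ γ (ofPowerSeries ℤ _ (expLogSeries α) * f) := by
  have h1 (f : FockLaurent l) :
      applySeries (fun e => if 0 < e then ((e : ℂ)⁻¹) • modeDot α (-e) else 0) (place κ₀ γ f) =
        place κ₀ γ (ofPowerSeries ℤ _ (logSeries α) * f) := by
    refine applySeries_place (a := fun e x =>
      (if 0 ≤ e then PowerSeries.coeff e.toNat (logSeries α) else 0) * x) (fun e x => ?_)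
      fun k => (coeff_ofPowerSeries_mul _ _ _).symm
    rcases lt_trichotomy e 0 with he | rfl | he
    · rw [if_neg (by omega), if_neg (by omega)]; simp
    · simp [constantCoeff_logSeries]
    · rw [if_pos he, if_pos he.le]
      obtain ⟨n, rfl⟩ : ∃ n : ℕ, e = n + 1 := ⟨(e - 1).toNat, by omega⟩
      have h2 : -((n : ℤ) + 1) = -(n : ℤ) - 1 := by ring
      have h3 : ((n : ℤ) + 1).toNat = n + 1 := by omega
      rw [LinearMap.smul_apply, modeDot_single, h2, h3, logSeries, PowerSeries.coeff_mk, fockDot,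
        Finsupp.smul_single]
      simp only [modeOn_neg, Nat.add_sub_cancel, smul_mul_assoc, Finset.sum_mul]
      push_cast
      rfl
  have h2 (m : ℕ) : (applySeries (fun e => if 0 < e then ((e : ℂ)⁻¹) • modeDot α (-e) else 0))^[m]
      (place κ₀ γ f) =
        place κ₀ γ ((fun h => ofPowerSeries ℤ _ (logSeries α) * h)^[m] f) := by
    induction m with
    | zero => rfl
    | succ m ih => rw [Function.iterate_succ_apply', ih, h1, Function.iterate_succ_apply']
  refine eq_place (fun k => ?_) fun κ hκ => ?_
  · rw [expLogSeries, coeff_ofPowerSeries_expPS_mul (constantCoeff_logSeries α), map_finsum_single,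
      Yminus, expSeries]
    refine finsum_congr fun m => ?_
    rw [h2, place_apply, Finsupp.smul_single]
  · rw [Yminus, expSeries, finsum_eq_zero_of_forall_eq_zero]
    intro m
    rw [h2, place_apply_of_not hκ, smul_zero]

end Modes

/-! ### Polynomial states, on which annihilation operators act through finite sums. -/

section Finite

open MvPolynomial

/-- Polynomials in the variables `a^i(-n-1)` over the ring of Laurent series. -/
abbrev FockPoly (l : ℕ) : Type := MvPolynomial (Fin l × ℕ) (FockLaurent l)

/-- The inclusion of the Fock space into `FockPoly l`. -/
def embFock : Fock l →+* FockPoly l :=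
  MvPolynomial.map (HahnSeries.C.comp MvPolynomial.C)

/-- The evaluation of the variables of `FockPoly l` in the coefficients of Laurent series. -/
def evalFock : FockPoly l →ₐ[FockLaurent l] FockLaurent l :=
  aeval fun p => HahnSeries.C (X p)

theorem evalFock_embFock (x : Fock l) : evalFock (embFock x) = HahnSeries.C x := by
  induction x using MvPolynomial.induction_on with
  | C a => simp [evalFock, embFock]
  | add p q hp hq => rw [map_add, map_add, hp, hq, map_add]
  | mul_X p q hp =>
    rw [map_mul, map_mul, hp, map_mul]
    simp [evalFock, embFock]

/-- The span of the `z^{-n} x` with `n ≥ N` and `x` in the Fock space. -/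
def finSpan (l N : ℕ) : AddSubmonoid (FockPoly l) :=
  AddSubmonoid.closure
    {y | ∃ n : ℕ, N ≤ n ∧ ∃ x : Fock l, y = MvPolynomial.C (single (-n : ℤ) 1) * embFock x}

theorem finSpan_anti {N M : ℕ} (h : N ≤ M) : finSpan l M ≤ finSpan l N :=
  AddSubmonoid.closure_mono fun _ ⟨n, hn, hx⟩ => ⟨n, h.trans hn, hx⟩

theorem mul_mem_finSpan {N M : ℕ} {f g : FockPoly l} (hf : f ∈ finSpan l N)
    (hg : g ∈ finSpan l M) {K : ℕ} (hK : K ≤ N + M) : f * g ∈ finSpan l K := by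
  refine finSpan_anti hK ?_
  induction hf using AddSubmonoid.closure_induction with
  | zero => simp
  | add f₁ f₂ _ _ h₁ h₂ => rw [add_mul]; exact add_mem h₁ h₂
  | mem f hf =>
    induction hg using AddSubmonoid.closure_induction with
    | zero => simp
    | add g₁ g₂ _ _ h₁ h₂ => rw [mul_add]; exact add_mem h₁ h₂
    | mem g hg =>
      obtain ⟨n, hn, x, rfl⟩ := hf
      obtain ⟨m, hm, y, rfl⟩ := hg
      refine AddSubmonoid.subset_closure ⟨n + m, by omega, x * y, ?_⟩
      rw [mul_mul_mul_comm, ← map_mul, ← map_mul, single_mul_single, one_mul]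
      push_cast
      rw [neg_add]

theorem C_single_mem_finSpan {N n : ℕ} (h : N ≤ n) (a : ℂ) :
    (MvPolynomial.C (single (-n : ℤ) (MvPolynomial.C a)) : FockPoly l) ∈ finSpan l N := by
  refine AddSubmonoid.subset_closure ⟨n, h, MvPolynomial.C a, ?_⟩
  rw [embFock, MvPolynomial.map_C, ← map_mul, RingHom.comp_apply, HahnSeries.C_apply, single_mul_single,
    one_mul, add_zero]

theorem embFock_mem_finSpan (x : Fock l) : embFock x ∈ finSpan l 0 :=
  AddSubmonoid.subset_closure ⟨0, le_rfl, x, by simp⟩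

theorem evalFock_C_single_mul (n : ℕ) (f : FockPoly l) (k : ℤ) :
    (evalFock (MvPolynomial.C (single (-n : ℤ) 1) * f)).coeff k =
      (evalFock f).coeff (k + n) := by
  have h : evalFock (MvPolynomial.C (single (-n : ℤ) (1 : Fock l)) : FockPoly l) =
      single (-n : ℤ) 1 := by simp [evalFock]
  have e : k = k + n + -(n : ℤ) := by ring
  conv_lhs => rw [e]
  rw [map_mul, h, coeff_single_mul_add, one_mul]

theorem support_evalFock_finite {N : ℕ} {f : FockPoly l} (hf : f ∈ finSpan l N) :
    (evalFock f).coeff.support.Finite := by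
  induction hf using AddSubmonoid.closure_induction with
  | zero => rw [map_zero, HahnSeries.coeff_zero', Function.support_zero]; exact Set.finite_empty
  | add f₁ f₂ _ _ h₁ h₂ =>
    refine (h₁.union h₂).subset ?_
    rw [map_add, HahnSeries.coeff_add']
    exact Function.support_add _ _
  | mem f hf =>
    obtain ⟨n, -, x, rfl⟩ := hf
    refine (Set.finite_singleton (-n : ℤ)).subset fun k hk => ?_
    rw [Function.mem_support, evalFock_C_single_mul, evalFock_embFock, HahnSeries.C_apply] at hk
    have := mt coeff_single_of_ne hk
    simp only [Set.mem_singleton_iff]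
    omega

theorem coeff_evalFock_of_mem {N : ℕ} {f : FockPoly l} (hf : f ∈ finSpan l N) {k : ℤ}
    (hk : -N < k) : (evalFock f).coeff k = 0 := by
  induction hf using AddSubmonoid.closure_induction with
  | zero => simp
  | add f₁ f₂ _ _ h₁ h₂ => rw [map_add, HahnSeries.coeff_add, h₁, h₂, add_zero]
  | mem f hf =>
    obtain ⟨n, hn, x, rfl⟩ := hf
    rw [evalFock_C_single_mul, evalFock_embFock, HahnSeries.C_apply, coeff_single_of_ne (by omega)]

/-- The index bounds exponents of `z` by `-N`; keeping track of it shows later that two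
annihilations miss `z^{-1}`. -/
theorem apply_mem_finSpan {D : FockPoly l →ₗ[FockLaurent l] FockPoly l} {N M : ℕ}
    (hD : ∀ x, D (embFock x) ∈ finSpan l M) {f : FockPoly l} (hf : f ∈ finSpan l N) :
    D f ∈ finSpan l (N + M) := by
  induction hf using AddSubmonoid.closure_induction with
  | zero => simp
  | add f₁ f₂ _ _ h₁ h₂ => rw [map_add]; exact add_mem h₁ h₂
  | mem f hf =>
    obtain ⟨n, hn, x, rfl⟩ := hf
    rw [← smul_eq_C_mul, map_smul, smul_eq_C_mul]
    have h := C_single_mem_finSpan (l := l) hn 1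
    rw [map_one] at h
    exact mul_mem_finSpan h (hD x) le_rfl

/-- `D` is linear over Laurent series and elements of `finSpan` are finite sums of `z^{-n} x`, so it
suffices to know the modes on the Fock space. -/
theorem finsum_coeff_evalFock {D : FockPoly l →ₗ[FockLaurent l] FockPoly l}
    {a : ℤ → Fock l → Fock l} (ha : ∀ e x, a e x = (evalFock (D (embFock x))).coeff e)
    {N : ℕ} {f : FockPoly l} (hf : f ∈ finSpan l N) (k : ℤ) :
    ∑ᶠ e : ℤ, a e ((evalFock f).coeff (k - e)) = (evalFock (D f)).coeff k := by
  have ha0 (e : ℤ) : a e 0 = 0 := by simp [ha]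
  have haa (e : ℤ) (x y : Fock l) : a e (x + y) = a e x + a e y := by simp [ha]
  have hs {f : FockPoly l} (hf : f ∈ finSpan l N) :
      (Function.support fun e => a e ((evalFock f).coeff (k - e))).Finite := by
    refine ((support_evalFock_finite hf).preimage
      (f := fun e => k - e) (sub_right_injective.injOn)).subset fun e he => ?_
    rw [Function.mem_support] at he
    exact fun h => he (by rw [h, ha0])
  induction hf using AddSubmonoid.closure_induction with
  | zero => simp [ha0]
  | add f₁ f₂ m₁ m₂ h₁ h₂ =>
    simp only [map_add, HahnSeries.coeff_add, haa]
    rw [finsum_add_distrib (hs m₁) (hs m₂), h₁, h₂]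
  | mem f hf =>
    obtain ⟨n, hn, x, rfl⟩ := hf
    simp only [evalFock_C_single_mul, evalFock_embFock, HahnSeries.C_apply]
    rw [finsum_eq_single _ (k + n)]
    · rw [show k - (k + n) + n = 0 by ring, coeff_single_same, ha, ← smul_eq_C_mul, map_smul,
        smul_eq_C_mul, evalFock_C_single_mul]
    · intro e he
      rw [coeff_single_of_ne (by omega), ha0]

theorem contraction_embFock_mem {g : Fin l × ℕ → FockLaurent l} {M : ℕ}
    (hg : ∀ q, (MvPolynomial.C (g q) : FockPoly l) ∈ finSpan l M) (x : Fock l) :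
    contraction g (embFock x) ∈ finSpan l M := by
  induction x using MvPolynomial.induction_on with
  | C a => simp [embFock]
  | add p q hp hq => rw [map_add, map_add]; exact add_mem hp hq
  | mul_X p q hp =>
    have hX : embFock (X q : Fock l) = X q := by simp [embFock]
    rw [map_mul, hX, contraction_mul_X]
    refine add_mem ?_ ?_
    · rw [← hX]
      exact mul_mem_finSpan hp (embFock_mem_finSpan (X q)) le_rfl
    · exact mul_mem_finSpan (hg q) (embFock_mem_finSpan p) le_rfl

theorem coeff_evalFock_contraction (g : Fin l × ℕ → FockLaurent l) (x : Fock l) (e : ℤ) :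
    (evalFock (contraction g (embFock x))).coeff e =
      mkDerivation ℂ (fun q => (g q).coeff e) x := by
  induction x using MvPolynomial.induction_on with
  | C a => simp [embFock]
  | add p q hp hq => rw [map_add, map_add, map_add, map_add, HahnSeries.coeff_add, hp, hq]
  | mul_X p q hp =>
    have hX : embFock (X q : Fock l) = X q := by simp [embFock]
    have hX' : evalFock (X q : FockPoly l) = HahnSeries.C (X q) := by simp [evalFock]
    have hC : evalFock (MvPolynomial.C (g q) : FockPoly l) = g q := by simp [evalFock]
    rw [map_mul, hX, contraction_mul_X, map_add, map_mul, map_mul, hX', hC, evalFock_embFock,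
      mul_comm _ (HahnSeries.C (X q)), mul_comm _ (HahnSeries.C p), C_mul_eq_smul, C_mul_eq_smul,
      HahnSeries.coeff_add, HahnSeries.coeff_smul, HahnSeries.coeff_smul, hp,
      Derivation.leibniz, mkDerivation_X,
      add_comm]

theorem translation_embFock_mem {d : Fin l × ℕ → FockLaurent l}
    (hd : ∀ q, (MvPolynomial.C (d q) : FockPoly l) ∈ finSpan l 0) (x : Fock l) :
    translation d (embFock x) ∈ finSpan l 0 := by
  induction x using MvPolynomial.induction_on with
  | C a =>
    have h : translation d (embFock (MvPolynomial.C a)) = embFock (MvPolynomial.C a) := by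
      simp [embFock]
    rw [h]
    exact embFock_mem_finSpan _
  | add p q hp hq => rw [map_add, map_add]; exact add_mem hp hq
  | mul_X p q hp =>
    have hX : embFock (X q : Fock l) = X q := by simp [embFock]
    rw [map_mul, map_mul, hX, translation_X, ← hX]
    exact mul_mem_finSpan hp (add_mem (embFock_mem_finSpan _) (hd q)) le_rfl

end Finite

end Heisenberg

end

noncomputable section

namespace Heisenberg

open HahnSeries

variable {l : ℕ}

/-! ### Heisenberg fields as Wick data. -/

section Fields

open MvPolynomial

/-- The contraction of the field of `a^i(-k-1) 𝟏` with `a^j(-m-1)`. -/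
def fieldPairing (p q : Fin l × ℕ) : FockLaurent l :=
  if p.1 = q.1 then
    -- With `k = p.2` and `m = q.2`, this is `binom(-n-1, k) n z^{-n-1-k}` at `n = m + 1`, the
    -- factor `n` being `[a(n), a(-n)]`.
    single (-((p.2 + q.2 + 2 : ℕ) : ℤ))
      (MvPolynomial.C ((-1) ^ p.2 * (p.2 + q.2 + 1).choose p.2 * (q.2 + 1)))
  else 0

/-- The zero mode `β^i binom(-1, k) z^{-k-1}` of the field of `a^i(-k-1) 𝟏` on `M_β`. -/
def fieldZeroMode (β : Fin l → ℂ) (p : Fin l × ℕ) : FockLaurent l :=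
  single (-((p.2 + 1 : ℕ) : ℤ)) (MvPolynomial.C ((-1) ^ p.2 * β p.1))

/-- The shift `a^i(-n-1) ↦ a^i(-n-1) - α^i z^{-n-1}` effected by `Y_+(α, z)`. -/
def plusShift (α : Fin l → ℂ) (p : Fin l × ℕ) : FockLaurent l :=
  single (-((p.2 + 1 : ℕ) : ℤ)) (MvPolynomial.C (-α p.1))

/-- The fields of the Heisenberg algebra on `M_β`. -/
def fieldData (β : Fin l → ℂ) : WickData (Fin l × ℕ) (FockLaurent l) where
  create p := ofPowerSeries ℤ _ (createSeries p)
  embed p := HahnSeries.C (X p)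
  pairing := fieldPairing
  zeroMode := fieldZeroMode β

theorem C_fieldPairing_mem (p q : Fin l × ℕ) :
    (MvPolynomial.C (fieldPairing p q) : FockPoly l) ∈ finSpan l 1 := by
  rw [fieldPairing]
  split_ifs
  · exact C_single_mem_finSpan (by omega) _
  · simp

theorem C_fieldZeroMode_mem (β : Fin l → ℂ) (p : Fin l × ℕ) :
    (MvPolynomial.C (fieldZeroMode β p) : FockPoly l) ∈ finSpan l 1 :=
  C_single_mem_finSpan (by omega) _

theorem C_plusShift_mem (α : Fin l → ℂ) (p : Fin l × ℕ) :
    (MvPolynomial.C (plusShift α p) : FockPoly l) ∈ finSpan l 0 :=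
  C_single_mem_finSpan (by omega) _

/-- The annihilation part of the field of `a^i(-k-1) 𝟏` on `M_β`. -/
def fieldAnnihilation (β : Fin l → ℂ) (p : Fin l × ℕ) :
    FockPoly l →ₗ[FockLaurent l] FockPoly l :=
  annihilation (fieldPairing p) (fieldZeroMode β p)

theorem fieldAnnihilation_embFock_mem (β : Fin l → ℂ) (p : Fin l × ℕ) (x : Fock l) :
    fieldAnnihilation β p (embFock x) ∈ finSpan l 1 := by
  rw [fieldAnnihilation, annihilation_apply]
  exact add_mem (mul_mem_finSpan (C_fieldZeroMode_mem β p) (embFock_mem_finSpan x) le_rfl)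
    (contraction_embFock_mem (C_fieldPairing_mem p) x)

theorem mkDerivation_eq_zero {f : Fin l × ℕ → Fock l} (h : ∀ q, f q = 0) (x : Fock l) :
    mkDerivation ℂ f x = 0 := by
  have : mkDerivation ℂ f = 0 := derivation_ext fun q => by rw [mkDerivation_X, h]; rfl
  rw [this]
  rfl

theorem coeff_fieldZeroMode_mul (β : Fin l → ℂ) (p : Fin l × ℕ) (x : Fock l) (e : ℤ) :
    (fieldZeroMode β p * HahnSeries.C x).coeff e =
      if e = -((p.2 + 1 : ℕ) : ℤ) then ((-1) ^ p.2 * β p.1) • x else 0 := by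
  rw [fieldZeroMode, HahnSeries.C_apply, single_mul_single, add_zero, coeff_single,
    smul_eq_C_mul]
  congr

theorem coeff_evalFock_fieldAnnihilation (β : Fin l → ℂ) (p : Fin l × ℕ) (x : Fock l) (e : ℤ) :
    (evalFock (fieldAnnihilation β p (embFock x))).coeff e =
      (fieldZeroMode β p * HahnSeries.C x).coeff e +
        mkDerivation ℂ (fun q => (fieldPairing p q).coeff e) x := by
  have hC : evalFock (MvPolynomial.C (fieldZeroMode β p) : FockPoly l) = fieldZeroMode β p := by
    simp [evalFock]
  rw [fieldAnnihilation, annihilation_apply, map_add, map_mul, hC, evalFock_embFock,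
    HahnSeries.coeff_add, coeff_evalFock_contraction]

theorem coeff_fieldPairing_of_lt (p q : Fin l × ℕ) {e : ℤ} (he : -((p.2 + 1 : ℕ) : ℤ) ≤ e) :
    (fieldPairing p q).coeff e = 0 := by
  rw [fieldPairing]
  split_ifs
  · exact coeff_single_of_ne (by push_cast at he ⊢; omega)
  · rfl

theorem mkDerivation_fieldPairing (p : Fin l × ℕ) (m : ℕ) (x : Fock l) :
    mkDerivation ℂ (fun q => (fieldPairing p q).coeff (-((p.2 + m + 2 : ℕ) : ℤ))) x =
      ((-1 : ℂ) ^ p.2 * (p.2 + m + 1).choose p.2 * (m + 1)) • pderiv (p.1, m) x := by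
  have : mkDerivation ℂ (fun q => (fieldPairing p q).coeff (-((p.2 + m + 2 : ℕ) : ℤ))) =
      ((-1 : ℂ) ^ p.2 * (p.2 + m + 1).choose p.2 * (m + 1)) • pderiv (p.1, m) := by
    refine derivation_ext fun q => ?_
    rw [mkDerivation_X, Derivation.smul_apply, pderiv_X, fieldPairing]
    by_cases h1 : p.1 = q.1
    · rw [if_pos h1]
      by_cases h2 : m = q.2
      · subst h2
        rw [coeff_single_same, h1, Pi.single_eq_same, smul_eq_C_mul, mul_one]
      · rw [coeff_single_of_ne (by push_cast; omega), Pi.single_eq_of_ne, smul_zero]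
        rintro rfl
        exact h2 rfl
    · rw [if_neg h1, Pi.single_eq_of_ne, smul_zero]
      · rfl
      · rintro rfl
        exact h1 rfl
  rw [this]
  rfl

theorem negOnePow_smul (n : ℕ) (c : ℤ) : Int.negOnePow n • c = (-1) ^ n * c := by
  rw [Units.smul_def, Int.negOnePow_def]
  simp

theorem derivation_sum_apply {J : Type*} (s : Finset J) (D : J → Derivation ℂ (Fock l) (Fock l))
    (x : Fock l) : (∑ j ∈ s, D j) x = ∑ j ∈ s, D j x := by
  classical
  induction s using Finset.induction_on with
  | empty => simp
  | insert j s hj ih => rw [Finset.sum_insert hj, Finset.sum_insert hj, Derivation.add_apply, ih]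

/-- With `k = p.2`: below `-(k+1)` the mode annihilates, at `-(k+1)` it is the zero mode, and for
`-(k+1) < e < 0` a creation mode occurs but `binom(e+k, k) = 0`. -/
theorem coeff_fieldAnnihilation (β : Fin l → ℂ) (p : Fin l × ℕ) (x : Fock l) (e : ℤ) :
    (if e < 0 then (Ring.choose (e + p.2) p.2 : ℤ) • modeOn β p.1 (-e - 1 - p.2) x else 0) =
      (evalFock (fieldAnnihilation β p (embFock x))).coeff e := by
  rw [coeff_evalFock_fieldAnnihilation, coeff_fieldZeroMode_mul]
  rcases lt_trichotomy e (-((p.2 + 1 : ℕ) : ℤ)) with h | h | h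
  · obtain ⟨m, rfl⟩ : ∃ m : ℕ, e = -((p.2 + m + 2 : ℕ) : ℤ) :=
      ⟨(-e - p.2 - 2).toNat, by push_cast at h ⊢; omega⟩
    rw [if_pos (by omega), if_neg (by omega), zero_add, mkDerivation_fieldPairing]
    have h1 : -(-((p.2 + m + 2 : ℕ) : ℤ)) - 1 - p.2 = (m : ℤ) + 1 := by push_cast; ring
    have h2 : -((p.2 + m + 2 : ℕ) : ℤ) + p.2 = -((m : ℤ) + 2) := by push_cast; ring
    have h3 : (m : ℤ) + 2 + p.2 - 1 = ((p.2 + m + 1 : ℕ) : ℤ) := by push_cast; ring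
    rw [h1, h2, Ring.choose_neg, h3, Ring.choose_natCast, modeOn_succ, negOnePow_smul,
      ← Int.cast_smul_eq_zsmul ℂ, smul_smul]
    push_cast
    rfl
  · subst h
    rw [if_pos (by omega), if_pos rfl,
      mkDerivation_eq_zero fun q => coeff_fieldPairing_of_lt p q le_rfl, add_zero]
    have h1 : -(-((p.2 + 1 : ℕ) : ℤ)) - 1 - p.2 = 0 := by push_cast; ring
    have h2 : -((p.2 + 1 : ℕ) : ℤ) + p.2 = -1 := by push_cast; ring
    have h3 : (1 : ℤ) + p.2 - 1 = (p.2 : ℤ) := by ring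
    rw [h1, h2, Ring.choose_neg, h3, Ring.choose_natCast, modeOn_zero, negOnePow_smul,
      Nat.choose_self, ← Int.cast_smul_eq_zsmul ℂ, smul_smul]
    push_cast
    rw [mul_one]
  · rw [if_neg h.ne', mkDerivation_eq_zero fun q => coeff_fieldPairing_of_lt p q h.le, add_zero]
    split_ifs with he
    · obtain ⟨m, hm⟩ : ∃ m : ℕ, e + p.2 = m := ⟨(e + p.2).toNat, by push_cast at h; omega⟩
      rw [hm, Ring.choose_natCast, Nat.choose_eq_zero_of_lt (by omega)]
      simp
    · rfl

theorem derivFieldAnnihilate_place (κ₀ : ℂ) (β : Fin l → ℂ) (p : Fin l × ℕ) {f : FockPoly l}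
    {N : ℕ} (hf : f ∈ finSpan l N) :
    derivFieldAnnihilate p.1 p.2 (place κ₀ β (evalFock f)) =
      place κ₀ β (evalFock (fieldAnnihilation β p f)) := by
  refine applySeries_place (a := fun e x => if e < 0 then
      (Ring.choose (e + p.2) p.2 : ℤ) • modeOn β p.1 (-e - 1 - p.2) x else 0) (fun e x => ?_)
    (finsum_coeff_evalFock (fun e x => coeff_fieldAnnihilation β p x e) hf)
  split_ifs
  · rw [derivField_single]
  · simp

theorem normalOrder_place (κ₀ : ℂ) (β : Fin l → ℂ) (L : List (Fin l × ℕ)) {f : FockPoly l}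
    (hf : f ∈ finSpan l 0) :
    normalOrder L (place κ₀ β (evalFock f)) = place κ₀ β (wickList (fieldData β) L f) := by
  induction L generalizing f with
  | nil => rfl
  | cons p L ih =>
    have h := apply_mem_finSpan (fieldAnnihilation_embFock_mem β p) hf
    rw [normalOrder, ih hf, derivFieldCreate_place, derivFieldAnnihilate_place κ₀ β p hf,
      ih (finSpan_anti (Nat.zero_le _) h), ← map_add]
    rfl

theorem vertexOp_place (κ₀ : ℂ) (β : Fin l → ℂ) (u : Fock l) {f : FockPoly l}
    (hf : f ∈ finSpan l 0) :
    vertexOp u (place κ₀ β (evalFock f)) =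
      place κ₀ β (wick (fieldData β) (embFock u) f) := by
  conv_rhs => rw [u.as_sum]
  rw [map_sum, map_sum, LinearMap.sum_apply, map_sum, vertexOp]
  refine Finset.sum_congr rfl fun m _ => ?_
  rw [normalOrder_place κ₀ β _ hf, embFock, map_monomial, wick_monomial, LinearMap.smul_apply,
    smul_eq_mul, RingHom.comp_apply, place_C_mul]

theorem coeff_evalFock_contraction_plusShift (α β : Fin l → ℂ) (e : ℤ) (x : Fock l) :
    (if e < 0 then -((((-e : ℤ) : ℂ)⁻¹) • ∑ i, α i • modeOn β i (-e) x) else 0) =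
      (evalFock ((contraction (plusShift α)).toLinearMap (embFock x))).coeff e := by
  refine Eq.trans ?_ (coeff_evalFock_contraction _ _ _).symm
  split_ifs with he
  · obtain ⟨n, rfl⟩ : ∃ n : ℕ, e = -((n + 1 : ℕ) : ℤ) := ⟨(-e - 1).toNat, by omega⟩
    have h1 : - -((n + 1 : ℕ) : ℤ) = (n : ℤ) + 1 := by push_cast; ring
    have hn : (n : ℂ) + 1 ≠ 0 := by exact_mod_cast n.succ_ne_zero
    have h2 : mkDerivation ℂ (fun q => (plusShift α q).coeff (-((n + 1 : ℕ) : ℤ))) =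
        -∑ i, α i • pderiv (i, n) := by
      refine derivation_ext fun q => ?_
      have h3 : (-∑ i, α i • pderiv (i, n) : Derivation ℂ (Fock l) (Fock l)) (X q) =
          -∑ i, α i • pderiv (i, n) (X q) := by
        rw [Derivation.neg_apply, derivation_sum_apply]
        rfl
      rw [mkDerivation_X, h3, plusShift]
      simp only [pderiv_X]
      by_cases h4 : q.2 = n
      · subst h4
        rw [coeff_single_same, Finset.sum_eq_single q.1]
        · simp [smul_eq_C_mul]
        · intro i _ hi
          rw [Pi.single_eq_of_ne, smul_zero]
          intro h
          exact hi (congrArg Prod.fst h).symm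
        · simp
      · rw [coeff_single_of_ne (by push_cast; omega), Finset.sum_eq_zero, neg_zero]
        intro i _
        rw [Pi.single_eq_of_ne, smul_zero]
        rintro rfl
        exact h4 rfl
    rw [h2, h1, Derivation.neg_apply, derivation_sum_apply]
    simp only [modeOn_succ, Derivation.smul_apply]
    push_cast
    rw [Finset.smul_sum]
    congr 1
    refine Finset.sum_congr rfl fun i _ => ?_
    rw [smul_comm (α i), smul_smul, inv_mul_cancel₀ hn, one_smul]
  · refine (mkDerivation_eq_zero (fun q => ?_) x).symm
    exact coeff_single_of_ne (by push_cast; omega)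

theorem Yplus_place (κ₀ : ℂ) (α β : Fin l → ℂ) {f : FockPoly l} (hf : f ∈ finSpan l 0) :
    Yplus α (place κ₀ β (evalFock f)) =
      place κ₀ β (evalFock (translation (plusShift α) f)) := by
  -- Membership in `finSpan` is carried through the induction because each further step needs it for
  -- its finite sums.
  have h1 (m : ℕ) : (applySeries fun e =>
        if e < 0 then -((((-e : ℤ) : ℂ)⁻¹) • modeDot α (-e)) else 0)^[m]
        (place κ₀ β (evalFock f)) = place κ₀ β (evalFock ((contraction (plusShift α))^[m] f)) ∧
      (contraction (plusShift α))^[m] f ∈ finSpan l 0 := by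
    induction m with
    | zero => exact ⟨rfl, hf⟩
    | succ m ih =>
      rw [Function.iterate_succ_apply', Function.iterate_succ_apply', ih.1]
      refine ⟨?_, ?_⟩
      · refine applySeries_place (a := fun e x =>
            if e < 0 then -((((-e : ℤ) : ℂ)⁻¹) • ∑ i, α i • modeOn β i (-e) x) else 0)
          (fun e x => ?_) (finsum_coeff_evalFock
          (D := (contraction (plusShift α)).toLinearMap)
          (coeff_evalFock_contraction_plusShift α β) ih.2)
        split_ifs
        · rw [LinearMap.neg_apply, LinearMap.smul_apply, modeDot_single, Finsupp.smul_single,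
            Finsupp.single_neg]
        · simp
      · exact apply_mem_finSpan (D := (contraction (plusShift α)).toLinearMap)
          (contraction_embFock_mem (C_plusShift_mem α)) ih.2
  funext κ
  rw [Yplus, expSeries]
  simp only [(h1 _).1]
  exact finsum_iterate_contraction (plusShift α)
    ((Pi.evalAddMonoidHom (fun _ : ℂ => FullModule l) κ).comp
      ((place κ₀ β).comp evalFock.toRingHom.toAddMonoidHom)) f

end Fields

end Heisenberg

end

noncomputable section

namespace Heisenberg

open HahnSeries

variable {l : ℕ}

/-! ### Closed form of the intertwining operator. -/

section Intertwiner

theorem vertexOp_zero (f : Series l) : vertexOp 0 f = 0 := by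
  simp [vertexOp]

theorem expOp_place (ε : (Fin l → ℂ) → (Fin l → ℂ) → ℂ) (κ₀ : ℂ) (α β : Fin l → ℂ)
    (f : FockLaurent l) (κ : ℂ) :
    expOp ε α (place κ₀ β f κ) = ε α β • place κ₀ (α + β) f κ := by
  have h (x : Fock l) : expOp ε α (Finsupp.single β x) = ε α β • Finsupp.single (α + β) x := by
    simp [expOp, cocycleOp, expQ]
  by_cases hκ : ∃ n : ℤ, κ = κ₀ + n
  · obtain ⟨n, rfl⟩ := hκ
    rw [place_apply, place_apply, h]
  · rw [place_apply_of_not hκ, place_apply_of_not hκ, map_zero, smul_zero]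

theorem intertwiner_tensorExp (ε : (Fin l → ℂ) → (Fin l → ℂ) → ℂ) (α β : Fin l → ℂ)
    (u v : Fock l) :
    intertwiner ε (tensorExp u α) (tensorExp v β) =
      ε α β • place (α ⬝ᵥ β) (α + β) (ofPowerSeries ℤ _ (expLogSeries α) *
        wick (fieldData β) (embFock u) (translation (plusShift α) (embFock v))) := by
  have h0 : zPowZeroMode α (tensorExp v β) = place (α ⬝ᵥ β) β (evalFock (embFock v)) := by
    rw [zPowZeroMode, tensorExp, Finsupp.sum_single_index, tensorExp, Pi_single_eq_place,
      evalFock_embFock]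
    simp [tensorExp]
  have h1 : Yplus α (zPowZeroMode α (tensorExp v β)) =
      place (α ⬝ᵥ β) β (evalFock (translation (plusShift α) (embFock v))) := by
    rw [h0, Yplus_place _ _ _ (embFock_mem_finSpan v)]
  have h2 := translation_embFock_mem (C_plusShift_mem α) v
  rw [intertwiner]
  conv_lhs => rw [tensorExp]
  rw [Finsupp.sum_single_index]
  · funext κ
    rw [h1, vertexOp_place _ _ _ h2, Yminus_place, expOp_place]
    rfl
  · funext κ
    -- Zero is written as a placed Laurent series so that `Yminus_place` computes its image.
    rw [vertexOp_zero, ← map_zero (place (0 : ℂ) (0 : Fin l → ℂ)), Yminus_place, mul_zero,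
      map_zero]
    exact map_zero _

end Intertwiner

/-! ### `L(-1)` from the Virasoro vector, and `e^{zL(-1)}` after `z ↦ -z`. -/

section Virasoro

open MvPolynomial

theorem contraction_mul_left {I R : Type*} [CommRing R] (r : R) (g : I → R)
    (f : MvPolynomial I R) :
    contraction (fun q => r * g q) f = MvPolynomial.C r * contraction g f := by
  have : contraction (fun q => r * g q) = r • contraction g :=
    derivation_ext fun q => by
      rw [contraction_X, Derivation.smul_apply, contraction_X, smul_eq_C_mul, map_mul]
  rw [this, Derivation.smul_apply, smul_eq_C_mul]

theorem coeff_ofPowerSeries_mul_single {A : Type*} [CommRing A] (c : PowerSeries A) (n k : ℕ)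
    (r : A) :
    (ofPowerSeries ℤ A c * single (-(n + k : ℕ) : ℤ) r).coeff (-k : ℤ) =
      PowerSeries.coeff n c * r := by
  have h : (-k : ℤ) = n + -((n + k : ℕ) : ℤ) := by push_cast; ring
  rw [h, coeff_mul_single_add, ofPowerSeries_apply_coeff]

theorem coeff_createSeries_mul_annihilation (γ : Fin l → ℂ) (i : Fin l) (x : Fock l) :
    (ofPowerSeries ℤ _ (createSeries (i, 0)) *
        evalFock (fieldAnnihilation γ (i, 0) (embFock x))).coeff (-1) =
      (γ i • X (i, 0)) * x + mkDerivation ℂ (fun q =>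
        (ofPowerSeries ℤ _ (createSeries (i, 0)) * fieldPairing (i, 0) q).coeff (-1)) x := by
  have hC (r : FockLaurent l) : evalFock (MvPolynomial.C r : FockPoly l) = r := by
    simp [evalFock]
  rw [fieldAnnihilation, annihilation_apply, map_add, mul_add, HahnSeries.coeff_add,
    ← coeff_evalFock_contraction, contraction_mul_left, map_mul, map_mul, hC, hC,
    evalFock_embFock, fieldZeroMode, HahnSeries.C_apply, single_mul_single, add_zero]
  congr 1
  have := coeff_ofPowerSeries_mul_single (createSeries (i, 0)) 0 1
    (MvPolynomial.C ((-1) ^ 0 * γ i) * x)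
  simp only [zero_add, Nat.cast_one] at this ⊢
  rw [this, createSeries, PowerSeries.coeff_mk]
  simp only [pow_zero, one_mul, add_zero, Nat.choose_self, Nat.cast_one, one_smul, smul_eq_C_mul]
  ring

theorem sum_mkDerivation_fieldPairing (x : Fock l) :
    ∑ i, mkDerivation ℂ (fun q =>
        (ofPowerSeries ℤ _ (createSeries (i, 0)) * fieldPairing (i, 0) q).coeff (-1)) x =
      fockTranslation l x := by
  rw [← derivation_sum_apply]
  congr 1
  refine derivation_ext fun q => ?_
  rw [derivation_sum_apply, fockTranslation, mkDerivation_X, Finset.sum_eq_single q.1]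
  · rw [mkDerivation_X, fieldPairing, if_pos rfl]
    have := coeff_ofPowerSeries_mul_single (createSeries (q.1, 0)) (q.2 + 1) 1
      (MvPolynomial.C ((-1) ^ 0 * (0 + q.2 + 1).choose 0 * ((q.2 : ℂ) + 1)))
    simp only [zero_add, Nat.cast_one] at this ⊢
    rw [this, createSeries, PowerSeries.coeff_mk]
    simp only [pow_zero, one_mul, zero_add, Nat.choose_zero_right, Nat.cast_one, one_smul,
      smul_eq_C_mul]
    ring
  · intro i _ hi
    rw [mkDerivation_X, fieldPairing, if_neg hi, mul_zero]
    rfl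
  · simp

theorem wick_X_mul_X (w : WickData (Fin l × ℕ) (FockLaurent l)) (p : Fin l × ℕ)
    (f : FockPoly l) :
    wick w (X p * X p) f =
      w.create p * (w.create p * aeval w.embed f) +
        2 * (w.create p * aeval w.embed (annihilation (w.pairing p) (w.zeroMode p) f)) +
        aeval w.embed (annihilation (w.pairing p) (w.zeroMode p)
          (annihilation (w.pairing p) (w.zeroMode p) f)) := by
  have h (f : FockPoly l) : wick w (X p) f = w.create p * aeval w.embed f +
      aeval w.embed (annihilation (w.pairing p) (w.zeroMode p) f) := by
    have := wick_mul_X w p 1 f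
    rwa [one_mul, ← C_1, wick_C, wick_C, one_mul, one_mul] at this
  rw [wick_mul_X, h, h]
  ring

/-- Two creation parts give no negative power, two annihilation parts only exponents at most `-2`.
The mixed term remains, and its `2` cancels the `1/2` in `ω`. -/
theorem coeff_wick_X_mul_X (γ : Fin l → ℂ) (i : Fin l) (x : Fock l) :
    (wick (fieldData γ) (X (i, 0) * X (i, 0)) (embFock x)).coeff (-1) =
      2 * (ofPowerSeries ℤ _ (createSeries (i, 0)) *
        evalFock (fieldAnnihilation γ (i, 0) (embFock x))).coeff (-1) := by
  have h1 : (ofPowerSeries ℤ _ (createSeries (i, 0)) *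
      (ofPowerSeries ℤ _ (createSeries (i, 0)) * evalFock (embFock x))).coeff (-1) = 0 := by
    rw [evalFock_embFock, ← ofPowerSeries_C, ← map_mul, ← map_mul, PowerSeries.coeff_coe,
      if_pos (by norm_num)]
  have h2 : (evalFock (fieldAnnihilation γ (i, 0)
      (fieldAnnihilation γ (i, 0) (embFock x)))).coeff (-1) = 0 := by
    have := apply_mem_finSpan (fieldAnnihilation_embFock_mem γ (i, 0))
      (fieldAnnihilation_embFock_mem γ (i, 0) x)
    exact coeff_evalFock_of_mem this (by norm_num)
  rw [wick_X_mul_X, HahnSeries.coeff_add, HahnSeries.coeff_add]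
  refine (congrArg₂ _ (congrArg₂ _ h1 rfl) h2).trans ?_
  rw [zero_add, add_zero, two_mul, HahnSeries.coeff_add, ← two_mul]
  rfl

theorem virasoro_neg_one_single (γ : Fin l → ℂ) (x : Fock l) :
    virasoro (-1) (Finsupp.single γ x) = Finsupp.single γ (fockL γ x) := by
  have he : (-((-1 : ℤ) : ℂ) - 2) = 0 + ((-1 : ℤ) : ℂ) := by norm_num
  rw [virasoro, Pi_single_eq_place, ← evalFock_embFock,
    vertexOp_place _ _ _ (embFock_mem_finSpan x), he, place_apply]
  congr 1
  have hω : embFock (virasoroVector l) =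
      (HahnSeries.C (MvPolynomial.C (2⁻¹ : ℂ)) : FockLaurent l) • ∑ i : Fin l, X (i, 0) * X (i, 0) := by
    rw [virasoroVector, smul_eq_C_mul, smul_eq_C_mul, map_mul, map_sum]
    simp [embFock, pow_two]
  have hsum (F : Fin l → FockLaurent l) (k : ℤ) :
      (∑ i, F i).coeff k = ∑ i, (F i).coeff k := by
    exact map_sum (HahnSeries.coeff.addMonoidHom k) F Finset.univ
  rw [hω, map_smul, LinearMap.smul_apply, smul_eq_mul, C_mul_eq_smul, HahnSeries.coeff_smul,
    map_sum, LinearMap.sum_apply, hsum]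
  simp only [coeff_wick_X_mul_X, coeff_createSeries_mul_annihilation]
  rw [← Finset.mul_sum, Finset.sum_add_distrib, sum_mkDerivation_fieldPairing, smul_eq_mul,
    ← mul_assoc]
  have h2 : (MvPolynomial.C (2⁻¹ : ℂ) * 2 : Fock l) = 1 := by
    have : (2 : Fock l) = MvPolynomial.C 2 := (map_ofNat _ 2).symm
    rw [this, ← map_mul]
    norm_num
  rw [h2, one_mul, fockL_apply, fockDot, Finset.sum_mul, add_comm]

theorem iterate_virasoro_neg_one_single (γ : Fin l → ℂ) (m : ℕ) (x : Fock l) :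
    (virasoro (-1))^[m] (Finsupp.single γ x) = Finsupp.single γ ((fockL γ)^[m] x) := by
  induction m generalizing x with
  | zero => rfl
  | succ m ih =>
    rw [Function.iterate_succ_apply, virasoro_neg_one_single, ih, Function.iterate_succ_apply]

/-- Oddness of `N` makes every branch restrict to the sign `(-1)^n` on integral powers. -/
theorem exp_pi_mul_odd_mul {N : ℤ} (hN : Odd N) (κ₀ : ℂ) (n : ℤ) :
    Complex.exp (Complex.I * Real.pi * N * (κ₀ + n)) =
      Complex.exp (Complex.I * Real.pi * N * κ₀) * (-1) ^ n := by
  rw [mul_add, Complex.exp_add]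
  congr 1
  have h : Complex.I * Real.pi * N * n = ((N * n : ℤ) : ℂ) * (Real.pi * Complex.I) := by
    push_cast; ring
  rw [h, Complex.exp_int_mul, Complex.exp_pi_mul_I, zpow_mul, hN.neg_one_zpow]

theorem expL_substNeg_place {N : ℤ} (hN : Odd N) (κ₀ a : ℂ) (γ : Fin l → ℂ)
    (f : FockLaurent l) :
    expL (substNeg N (a • place κ₀ γ f)) =
      (a * Complex.exp (Complex.I * Real.pi * N * κ₀)) •
        place κ₀ γ (ofPowerSeries ℤ _ (expLogSeries γ) * reflect (fockTranslation l) f) := by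
  rw [← place_C_mul _ _ (a * _)]
  refine eq_place (fun k => ?_) fun κ hκ => ?_
  · rw [C_mul_eq_smul, HahnSeries.coeff_smul, smul_eq_mul, ← smul_eq_C_mul,
      coeff_expLogSeries_mul_reflect, smul_finsum, map_finsum_single, expL]
    refine finsum_congr fun m => ?_
    have h : κ₀ + (k : ℂ) - m = κ₀ + ((k - m : ℤ) : ℂ) := by push_cast; ring
    rw [substNeg, h, Pi.smul_apply, place_apply, exp_pi_mul_odd_mul hN, Finsupp.smul_single,
      Finsupp.smul_single, iterate_virasoro_neg_one_single, Finsupp.smul_single, smul_smul]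
    congr 1
    rw [← Module.End.pow_apply, ← Module.End.pow_apply, map_smul, map_smul, smul_smul, smul_smul,
      smul_smul]
    congr 1
    ring
  · rw [expL, finsum_eq_zero_of_forall_eq_zero]
    intro m
    have h := not_exists_sub hκ m
    rw [Int.cast_natCast] at h
    -- `virasoro` is a bare function, so its value at zero is read off from the formula on a single
    -- charge.
    have h0 : (virasoro (-1))^[m] (0 : FullModule l) = 0 := by
      have := iterate_virasoro_neg_one_single (0 : Fin l → ℂ) m 0
      rwa [iterate_map_zero, Finsupp.single_zero] at this
    rw [substNeg, Pi.smul_apply, place_apply_of_not h, smul_zero, smul_zero, h0, smul_zero]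

end Virasoro

/-! ### Reflection exchanges the roles of the two states. -/

section Reflect

open MvPolynomial

theorem rescale_neg_one_C (x : Fock l) :
    PowerSeries.rescale (-1) (PowerSeries.C x) = PowerSeries.C x := by
  ext1 n
  rw [PowerSeries.coeff_rescale, PowerSeries.coeff_C]
  split_ifs with hn
  · rw [hn, pow_zero, one_mul]
  · rw [mul_zero]

theorem reflect_C_C (a : ℂ) :
    reflect (fockTranslation l) (HahnSeries.C (MvPolynomial.C a)) =
      HahnSeries.C (MvPolynomial.C a) := by
  rw [← ofPowerSeries_C, reflect_ofPowerSeries]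
  congr 1
  rw [rescale_neg_one_C, expZHom_apply]
  ext1 n
  rw [coeff_expZ_C, PowerSeries.coeff_C, dividedPow_apply]
  cases n with
  | zero => simp
  | succ n =>
    have : (fockTranslation l).toLinearMap (MvPolynomial.C a) = 0 := derivation_C _ _
    rw [Function.iterate_succ_apply, this, iterate_map_zero, smul_zero, if_neg n.succ_ne_zero]

theorem reflect_single (n : ℕ) (a : ℂ) :
    reflect (fockTranslation l) (single (-n : ℤ) (MvPolynomial.C a)) =
      single (-n : ℤ) (MvPolynomial.C ((-1) ^ n * a)) := by
  have h (b : ℂ) : (single (-n : ℤ) (MvPolynomial.C b) : FockLaurent l) =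
      single (-n : ℤ) 1 * HahnSeries.C (MvPolynomial.C b) := by
    rw [HahnSeries.C_apply, single_mul_single, add_zero, one_mul]
  rw [h, h, map_mul, reflect_C_C, reflect_single_neg]
  simp only [map_mul, map_pow, map_neg, map_one]
  ring

theorem map_reflect_embFock (x : Fock l) :
    MvPolynomial.map (reflect (fockTranslation l)) (embFock x) = embFock x := by
  rw [embFock, MvPolynomial.map_map]
  congr 2
  exact RingHom.ext reflect_C_C

theorem reflect_fieldZeroMode (α : Fin l → ℂ) (p : Fin l × ℕ) :
    reflect (fockTranslation l) (fieldZeroMode α p) = plusShift α p := by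
  rw [fieldZeroMode, reflect_single, plusShift, ← mul_assoc, ← _root_.pow_add]
  congr 2
  rw [Odd.neg_one_pow ⟨p.2, by ring⟩, neg_one_mul]

theorem reflect_plusShift (α : Fin l → ℂ) (p : Fin l × ℕ) :
    reflect (fockTranslation l) (plusShift α p) = fieldZeroMode α p := by
  rw [plusShift, reflect_single, fieldZeroMode]
  congr 2
  rw [pow_succ]
  ring

/-- With `k = p.2` and `m = q.2`, `binom(k+m+1, k)(m+1) = (k+m+1)!/(k! m!)` is symmetric, and the
sign `(-1)^{k+m}` from `z ↦ -z` turns `(-1)^k` into `(-1)^m`. -/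
theorem reflect_fieldPairing (p q : Fin l × ℕ) :
    reflect (fockTranslation l) (fieldPairing p q) = fieldPairing q p := by
  rw [fieldPairing, fieldPairing]
  by_cases h : p.1 = q.1
  · rw [if_pos h, if_pos h.symm, reflect_single, add_comm q.2 p.2]
    congr 2
    have h1 : ((-1 : ℂ) ^ (p.2 + q.2 + 2)) * (-1) ^ p.2 = (-1) ^ q.2 := by
      rw [← _root_.pow_add, show p.2 + q.2 + 2 + p.2 = 2 * (p.2 + 1) + q.2 by ring,
        _root_.pow_add, pow_mul]
      simp
    have h2 : ((p.2 + q.2 + 1).choose p.2 : ℂ) * (q.2 + 1) =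
        (p.2 + q.2 + 1).choose q.2 * (p.2 + 1) := by
      have e := Nat.choose_succ_right_eq (p.2 + q.2 + 1) p.2
      rw [show p.2 + q.2 + 1 - p.2 = q.2 + 1 by omega,
        Nat.choose_symm_of_eq_add (show p.2 + q.2 + 1 = p.2 + 1 + q.2 by ring)] at e
      exact_mod_cast e.symm
    rw [← mul_assoc, ← mul_assoc, h1, mul_assoc, h2, mul_assoc]
  · rw [if_neg h, if_neg (Ne.symm h), map_zero]

/-- Reflection sends a variable to its creation series, and back by `exp(zD) exp(-zD) = 1`. The
charge `β` is arbitrary because the swap replaces the zero modes. -/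
theorem map_fieldData (α β : Fin l → ℂ) :
    (fieldData α).map (reflect (fockTranslation l)) = (fieldData β).swap (plusShift α) := by
  unfold WickData.map WickData.swap fieldData
  congr 1
  · funext p
    rw [reflect_ofPowerSeries, expZHom_rescale_createSeries, ofPowerSeries_C]
  · funext p
    change reflect _ (HahnSeries.C (X p)) = ofPowerSeries ℤ _ (createSeries p)
    rw [← ofPowerSeries_C, reflect_ofPowerSeries, rescale_neg_one_C, expZHom_C_X]
  · funext p q
    exact reflect_fieldPairing p q
  · funext p
    exact reflect_fieldZeroMode α p

/-- Skew symmetry of the vertex operators without the exponential factors. -/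
theorem reflect_wick (α β : Fin l → ℂ) (u v : Fock l) :
    reflect (fockTranslation l)
        (wick (fieldData α) (embFock v) (translation (plusShift β) (embFock u))) =
      wick (fieldData β) (embFock u) (translation (plusShift α) (embFock v)) := by
  have h : (fun q => reflect (fockTranslation l) (plusShift β q)) = (fieldData β).zeroMode :=
    funext (reflect_plusShift β)
  rw [map_wick, map_translation, map_reflect_embFock, map_reflect_embFock, map_fieldData α β, h,
    wick_swap (fieldData β) (plusShift α)]

end Reflect

end Heisenberg

end

theorem mainTheorem7 (l : ℕ) (ε : (Fin l → ℂ) → (Fin l → ℂ) → ℂ)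
    (hε : Heisenberg.IsCocycleSystem ε) (N : ℤ) (hN : Odd N)
    (α β : Fin l → ℂ) (u v : Heisenberg.Fock l) :
    Heisenberg.intertwiner ε (Heisenberg.tensorExp u α) (Heisenberg.tensorExp v β) =
      (Complex.exp (-(Complex.I * Real.pi * N * (α ⬝ᵥ β))) * Heisenberg.commutator ε α β) •
        Heisenberg.expL (Heisenberg.substNeg N
          (Heisenberg.intertwiner ε (Heisenberg.tensorExp v β) (Heisenberg.tensorExp u α))) := by
  -- The exponential factors combine as `E_{α+β} ρ(E_β) = E_α E_β E_β⁻¹ = E_α`; only scalars are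
  -- left to compare.
  rw [Heisenberg.intertwiner_tensorExp, Heisenberg.intertwiner_tensorExp,
    Heisenberg.expL_substNeg_place hN, smul_smul,
    map_mul (Heisenberg.reflect _), Heisenberg.reflect_wick,
    Heisenberg.reflect_ofPowerSeries,
    ← mul_assoc (HahnSeries.ofPowerSeries ℤ (Heisenberg.Fock l) _), ← map_mul, add_comm β α,
    Heisenberg.expLogSeries_add, mul_assoc (Heisenberg.expLogSeries α),
    Heisenberg.expLogSeries_mul_cancel, mul_one, dotProduct_comm β α]
  congr 1
  rw [Heisenberg.commutator, Complex.exp_neg]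
  have h1 := hε.ne_zero β α
  have h2 := Complex.exp_ne_zero (Complex.I * Real.pi * N * (α ⬝ᵥ β))
  field_simp
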